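/- Let $G$ be a group with a finite nonempty generating set $S$ satisfying $S=S^{-1}$, and put $d=|S|$. For $x\in G$ let $|x|$ be the graph distance from the identity $e$ to $x$ in the right Cayley graph of $(G,S)$, where $x\sim y$ if and only if $y\in xS$. Let $(X_n)_{n\ge 0}$ be either simple random walk on $G$ started at $e$, i.e. the Markov chain with transition matrix $P_{\mathrm{SRW}}(x,y)=\frac1d\mathbf 1[y\in xS]$, or lazy random walk started at $e$, with transition matrix $\frac12(P_{\mathrm{SRW}}+I)$. For a discrete random variable $Y$ let $H(Y)=\sum_y \mathbb P(Y=y)\log\frac1{\mathbb P(Y=y)}$ be its entropy. **Theorem (Kaimanovich–Vershik–Varopoulos).** The speed $$v=\lim_{n\to\infty}\frac{\mathbb E|X_n|}{n}=\lim_{n\to\infty}\frac{|X_n|}{n}\quad\text{(the second limit almost surely)}$$ and the asymptotic entropy $$h=\lim_{n\to\infty}\frac{H(X_n)}{n}$$ exist as real numbers, and the following are equivalent: 1. $v>0$; 2. there is a bounded non-constant function $u:G\to\mathbb R$ that is harmonic, i.e. $u(x)=\frac1d\sum_{s\in S}u(xs)$ for all $x\in G$; 3. $h>0$. -/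

import Mathlib

open MeasureTheory Filter Topology

noncomputable section

namespace GroupWalk

/-- The word length `|x| = ρ(e, x)`: the graph distance from the identity to `x` in the right Cayley
graph of `G` with generating set `S` (where `x ~ y` iff `y ∈ x S`). -/
def wordLength {G : Type*} [Group G] (S : Finset G) (x : G) : ℕ :=
  (SimpleGraph.mulCayley (S : Set G)).dist 1 x

open Classical in
/-- Transition matrix of simple random walk: `p(x, y) = 1 / |S|` if `y ∈ x S`, and `0` otherwise. -/
def srw {G : Type*} [Group G] (S : Finset G) (x y : G) : ℝ :=
  if x⁻¹ * y ∈ S then 1 / (S.card : ℝ) else 0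

open Classical in
/-- Transition matrix of lazy random walk: `P = (P_SRW + I) / 2`. -/
def lazyRW {G : Type*} [Group G] (S : Finset G) (x y : G) : ℝ :=
  (srw S x y + if x = y then 1 else 0) / 2

/-- `X` is (a realization, on the probability space `(Ω, μ)`, of) the Markov chain with transition
matrix `p` started at `x₀`: each `X n` is measurable, for the discrete σ-algebra on the state space,
and `μ(X_0 = x_0, …, X_n = x_n) = 𝟙[x_0 = x₀] ∏_{i < n} p(x_i, x_{i+1})` for all paths. -/
structure IsMarkovChain {α Ω : Type*} [MeasurableSpace Ω] (p : α → α → ℝ) (x₀ : α)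
    (μ : Measure Ω) (X : ℕ → Ω → α) : Prop where
  measurable : ∀ n, Measurable[_, ⊤] (X n)
  path_law_start : ∀ (n : ℕ) (x : ℕ → α), x 0 = x₀ →
    μ.real {ω | ∀ i ≤ n, X i ω = x i} = ∏ i ∈ Finset.range n, p (x i) (x (i + 1))
  path_law_other : ∀ (n : ℕ) (x : ℕ → α), x 0 ≠ x₀ →
    μ.real {ω | ∀ i ≤ n, X i ω = x i} = 0

/-- The entropy `H(Y) = ∑ x, p_x log (1 / p_x)`, `p_x = μ(Y = x)`, of a discrete random variable. -/
def entropy {α Ω : Type*} [MeasurableSpace Ω] (μ : Measure Ω) (Y : Ω → α) : ℝ :=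
  ∑' x, μ.real {ω | Y ω = x} * Real.log (1 / μ.real {ω | Y ω = x})

/-- `u` is harmonic for simple random walk: `u(x) = |S|⁻¹ ∑_{s ∈ S} u(x s)`. -/
def IsHarmonic {G : Type*} [Group G] (S : Finset G) (u : G → ℝ) : Prop :=
  ∀ x, u x = 1 / (S.card : ℝ) * ∑ s ∈ S, u (x * s)

end GroupWalk

end

/-! The law of `X n` is the power `a ^ n` of the step distribution `a` in the real group algebra.
Mean length and entropy of `a ^ n` are subadditive in `n`, so Fekete's lemma gives `v` and `h`.

Speed against entropy: the Varopoulos–Carne bound `IsProb.coeff_pow_le` says that `a ^ n` gives `x`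
mass at most `2 exp(-|x|² / 2n)`, whence `v² / 2 ≤ h`; Gibbs' inequality against the weight
`(2d)^(-|x|)` gives `h ≤ v log(2d)` (`IsStep.speed_pos_iff_entropy_pos`).

Entropy against harmonic functions: `H (a ^ (n+1)) - H (a ^ n)` is the average over a first step `s`
of the relative entropy of `δ_s * a ^ n` with respect to `a ^ (n+1)`, and this relative entropy is
comparable with an `ℓ¹` distance in both directions (`IsProb.l1_sq_le_shiftKL`,
`IsProb.shiftKL_le_l1`). If `h = 0`, the first step is forgotten along some times, so a bounded
harmonic function takes the same value at `x` and `x s`. If `h > 0`, some first step is remembered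
infinitely often; averaging the sign functions that detect it and passing to an ultrafilter limit
gives a bounded non-constant function. Its harmonicity needs `a ^ n - a ^ (n+1)` to vanish in `ℓ¹`,
which periodicity can prevent for simple random walk, so this construction is carried out for the
lazy walk, which has the same harmonic functions.

Almost sure speed: the upper bound is the strong law applied to independent blocks; for the lower
bound, a greedy decomposition into short slow blocks shows that paths of lower speed below `c < v`
would pull the mean speed below `v` unless they have measure zero
(`IsStep.measure_slowSet_eq_zero`). -/

noncomputable section

/-! ### Finitely supported measures: integrals, `ℓ¹` norm, entropy, relative entropy. -/

namespace GroupWalk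

open Real

variable {G : Type*}

/-- The integral `∑ x, b(x) f(x)` of `f` against the finitely supported signed measure `b`. -/
def expect (f : G → ℝ) (b : MonoidAlgebra ℝ G) : ℝ :=
  b.coeff.sum fun x r => r * f x

lemma expect_eq_sum_of_subset (f : G → ℝ) (b : MonoidAlgebra ℝ G) {F : Finset G}
    (hF : b.coeff.support ⊆ F) : expect f b = ∑ x ∈ F, b.coeff x * f x :=
  Finsupp.sum_of_support_subset _ hF _ (by simp)

lemma expect_eq_sum (f : G → ℝ) (b : MonoidAlgebra ℝ G) :
    expect f b = ∑ x ∈ b.coeff.support, b.coeff x * f x := rfl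

@[simp] lemma expect_single (f : G → ℝ) (x : G) (r : ℝ) :
    expect f (MonoidAlgebra.single x r) = r * f x := by
  exact Finsupp.sum_single_index (by simp)

@[simp] lemma expect_zero (f : G → ℝ) : expect f (0 : MonoidAlgebra ℝ G) = 0 := by
  simp [expect]

lemma expect_add (f : G → ℝ) (b c : MonoidAlgebra ℝ G) :
    expect f (b + c) = expect f b + expect f c := by
  simp only [expect, MonoidAlgebra.coeff_add]
  exact Finsupp.sum_add_index' (by simp) (by intros; ring)

lemma expect_smul (f : G → ℝ) (r : ℝ) (b : MonoidAlgebra ℝ G) :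
    expect f (r • b) = r * expect f b := by
  simp only [expect, MonoidAlgebra.coeff_smul]
  rw [Finsupp.sum_smul_index' (by simp), Finsupp.mul_sum]
  simp [mul_assoc]

/-- `expect f` as a linear map. -/
def expectₗ (f : G → ℝ) : MonoidAlgebra ℝ G →ₗ[ℝ] ℝ where
  toFun := expect f
  map_add' := expect_add f
  map_smul' := expect_smul f

lemma expect_sub (f : G → ℝ) (b c : MonoidAlgebra ℝ G) :
    expect f (b - c) = expect f b - expect f c := map_sub (expectₗ f) b c

lemma expect_sum {ι : Type*} (f : G → ℝ) (s : Finset ι) (b : ι → MonoidAlgebra ℝ G) :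
    expect f (∑ i ∈ s, b i) = ∑ i ∈ s, expect f (b i) := map_sum (expectₗ f) b s

lemma expect_fun_add (f g : G → ℝ) (b : MonoidAlgebra ℝ G) :
    expect (fun x => f x + g x) b = expect f b + expect g b := by
  simp [expect_eq_sum, mul_add, Finset.sum_add_distrib]

lemma expect_fun_sub (f g : G → ℝ) (b : MonoidAlgebra ℝ G) :
    expect (fun x => f x - g x) b = expect f b - expect g b := by
  simp [expect_eq_sum, mul_sub, Finset.sum_sub_distrib]

lemma expect_fun_mul_left (r : ℝ) (f : G → ℝ) (b : MonoidAlgebra ℝ G) :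
    expect (fun x => r * f x) b = r * expect f b := by
  simp only [expect_eq_sum, Finset.mul_sum]
  exact Finset.sum_congr rfl fun _ _ => by ring

lemma expect_const (r : ℝ) (b : MonoidAlgebra ℝ G) :
    expect (fun _ => r) b = r * expect (fun _ => 1) b := by
  simpa using expect_fun_mul_left r (fun _ => 1) b

lemma expect_mono {f g : G → ℝ} {b : MonoidAlgebra ℝ G} (hb : ∀ x, 0 ≤ b.coeff x)
    (h : ∀ x, 0 < b.coeff x → f x ≤ g x) : expect f b ≤ expect g b :=
  Finset.sum_le_sum fun x hx =>
    mul_le_mul_of_nonneg_left (h x (lt_of_le_of_ne (hb x) (by simpa [eq_comm] using hx))) (hb x)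

lemma expect_nonneg {f : G → ℝ} {b : MonoidAlgebra ℝ G} (hb : ∀ x, 0 ≤ b.coeff x)
    (h : ∀ x, 0 < b.coeff x → 0 ≤ f x) : 0 ≤ expect f b := by
  simpa [expect] using expect_mono (f := fun _ => 0) hb h

lemma expect_mul [Group G] (f : G → ℝ) (b c : MonoidAlgebra ℝ G) :
    expect f (b * c) = expect (fun x => expect (fun y => f (x * y)) c) b := by
  induction b using MonoidAlgebra.induction_linear with
  | zero => simp
  | add b b' h h' => rw [add_mul, expect_add, h, h', expect_add]
  | single x r =>
    induction c using MonoidAlgebra.induction_linear with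
    | zero => simp
    | add c c' h h' =>
      rw [mul_add, expect_add, h, h']; simp only [expect_single, expect_add]; ring
    | single y t => simp [MonoidAlgebra.single_mul_single, mul_assoc]

/-- The `ℓ¹` norm. -/
def l1 (b : MonoidAlgebra ℝ G) : ℝ := ∑ x ∈ b.coeff.support, |b.coeff x|

lemma l1_eq_sum_of_subset (b : MonoidAlgebra ℝ G) {F : Finset G}
    (hF : b.coeff.support ⊆ F) : l1 b = ∑ x ∈ F, |b.coeff x| :=
  Finset.sum_subset hF fun x _ hx => by simpa using hx

lemma l1_nonneg (b : MonoidAlgebra ℝ G) : 0 ≤ l1 b := Finset.sum_nonneg fun _ _ => abs_nonneg _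

lemma abs_expect_le {f : G → ℝ} {C : ℝ} (hf : ∀ x, |f x| ≤ C) (b : MonoidAlgebra ℝ G) :
    |expect f b| ≤ C * l1 b := by
  rw [expect_eq_sum, l1, Finset.mul_sum]
  refine (Finset.abs_sum_le_sum_abs _ _).trans (Finset.sum_le_sum fun x _ => ?_)
  rw [abs_mul, mul_comm]
  exact mul_le_mul_of_nonneg_right (hf x) (abs_nonneg _)

lemma expect_sign_eq_l1 (b : MonoidAlgebra ℝ G) :
    expect (fun x => (SignType.sign (b.coeff x) : ℝ)) b = l1 b :=
  Finset.sum_congr rfl fun x _ => by simp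

/-- `b` is a finitely supported probability measure. -/
structure IsProb (b : MonoidAlgebra ℝ G) : Prop where
  nonneg : ∀ x, 0 ≤ b.coeff x
  total : expect (fun _ => 1) b = 1

lemma IsProb.expect_const {b : MonoidAlgebra ℝ G} (hb : IsProb b) (r : ℝ) :
    expect (fun _ => r) b = r := by
  rw [GroupWalk.expect_const, hb.total, mul_one]

lemma IsProb.sum_eq_one {b : MonoidAlgebra ℝ G} (hb : IsProb b) {F : Finset G}
    (hF : b.coeff.support ⊆ F) : ∑ x ∈ F, b.coeff x = 1 := by
  simpa using (expect_eq_sum_of_subset (fun _ => 1) b hF).symm.trans hb.total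

lemma IsProb.coeff_le_one {b : MonoidAlgebra ℝ G} (hb : IsProb b) (x : G) : b.coeff x ≤ 1 := by
  classical
  rw [← hb.sum_eq_one (Finset.subset_insert x _)]
  exact Finset.single_le_sum (f := fun y => b.coeff y) (fun y _ => hb.nonneg y)
    (Finset.mem_insert_self x _)

lemma IsProb.pos_of_ne {b : MonoidAlgebra ℝ G} (hb : IsProb b) {x : G} (hx : b.coeff x ≠ 0) :
    0 < b.coeff x := lt_of_le_of_ne (hb.nonneg x) hx.symm

lemma IsProb.abs_expect_le {b : MonoidAlgebra ℝ G} (hb : IsProb b) {f : G → ℝ} {C : ℝ}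
    (hf : ∀ x, |f x| ≤ C) : |expect f b| ≤ C := by
  rw [abs_le]
  constructor
  · rw [← hb.expect_const (-C)]
    exact expect_mono hb.nonneg fun x _ => (abs_le.1 (hf x)).1
  · conv_rhs => rw [← hb.expect_const C]
    exact expect_mono hb.nonneg fun x _ => (abs_le.1 (hf x)).2

lemma IsProb.single (x : G) : IsProb (MonoidAlgebra.single x (1 : ℝ)) where
  nonneg y := by
    classical
    rw [MonoidAlgebra.coeff_single, Finsupp.single_apply]; split_ifs <;> norm_num
  total := by simp

/-- The entropy of a finitely supported probability measure. -/
def H (b : MonoidAlgebra ℝ G) : ℝ := expect (fun x => -log (b.coeff x)) b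

lemma IsProb.H_nonneg {b : MonoidAlgebra ℝ G} (hb : IsProb b) : 0 ≤ H b :=
  expect_nonneg hb.nonneg fun x _ => by
    have := log_nonpos (hb.nonneg x) (hb.coeff_le_one x)
    linarith

lemma H_eq_sum_negMulLog (b : MonoidAlgebra ℝ G) {F : Finset G} (hF : b.coeff.support ⊆ F) :
    H b = ∑ x ∈ F, negMulLog (b.coeff x) := by
  rw [H, expect_eq_sum_of_subset _ _ hF]
  exact Finset.sum_congr rfl fun x _ => by rw [negMulLog]; ring

/-- A Pinsker inequality through the Hellinger distance: factor `|p - q| = |√p - √q| (√p + √q)` and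
apply Cauchy–Schwarz. The first factor is controlled by `log t ≤ t - 1` at `t = √(q/p)`, the second
has square sum at most `4`. -/
lemma IsProb.l1_sq_le {p q : MonoidAlgebra ℝ G} (hp : IsProb p) (hq : IsProb q)
    (hpq : ∀ x, 0 < p.coeff x → 0 < q.coeff x) :
    l1 (p - q) ^ 2 ≤ 4 * expect (fun x => log (p.coeff x) - log (q.coeff x)) p := by
  classical
  set F := p.coeff.support ∪ q.coeff.support
  have hF : (p - q).coeff.support ⊆ F := by
    rw [MonoidAlgebra.coeff_sub]; exact Finsupp.support_sub
  have hp1 := hp.sum_eq_one (Finset.subset_union_left : _ ⊆ F)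
  have hq1 := hq.sum_eq_one (Finset.subset_union_right : _ ⊆ F)
  rw [l1_eq_sum_of_subset _ hF, expect_eq_sum_of_subset _ _ (Finset.subset_union_left : _ ⊆ F)]
  have hsq : ∀ x, |(p - q).coeff x|
      = |√(p.coeff x) - √(q.coeff x)| * (√(p.coeff x) + √(q.coeff x)) := fun x => by
    rw [← abs_of_nonneg (add_nonneg (sqrt_nonneg (p.coeff x)) (sqrt_nonneg (q.coeff x))),
      ← abs_mul, MonoidAlgebra.coeff_sub, Finsupp.sub_apply]
    congr 1
    linear_combination -(sq_sqrt (hp.nonneg x)) + sq_sqrt (hq.nonneg x)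
  have hA : ∑ x ∈ F, |√(p.coeff x) - √(q.coeff x)| ^ 2
      ≤ ∑ x ∈ F, p.coeff x * (log (p.coeff x) - log (q.coeff x)) := by
    have : ∑ x ∈ F, |√(p.coeff x) - √(q.coeff x)| ^ 2
        = ∑ x ∈ F, 2 * (p.coeff x - √(p.coeff x) * √(q.coeff x)) := by
      rw [← sub_eq_zero, ← Finset.sum_sub_distrib]
      trans ∑ x ∈ F, (q.coeff x - p.coeff x)
      · refine Finset.sum_congr rfl fun x _ => ?_
        rw [sq_abs]
        linear_combination sq_sqrt (hp.nonneg x) + sq_sqrt (hq.nonneg x)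
      · rw [Finset.sum_sub_distrib, hp1, hq1, sub_self]
    rw [this]
    refine Finset.sum_le_sum fun x _ => ?_
    rcases (hp.nonneg x).eq_or_lt with h0 | h0
    · simp [← h0]
    have h1 := hpq x h0
    have h2 := log_le_sub_one_of_pos (div_pos (sqrt_pos.2 h1) (sqrt_pos.2 h0))
    rw [log_div (sqrt_pos.2 h1).ne' (sqrt_pos.2 h0).ne', log_sqrt h1.le, log_sqrt h0.le] at h2
    have h3 : p.coeff x * (√(q.coeff x) / √(p.coeff x)) = √(p.coeff x) * √(q.coeff x) := by
      nth_rewrite 1 [← mul_self_sqrt h0.le]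
      field_simp
    nlinarith
  have hB : ∑ x ∈ F, (√(p.coeff x) + √(q.coeff x)) ^ 2 ≤ 4 := by
    calc _ ≤ ∑ x ∈ F, 2 * (p.coeff x + q.coeff x) := Finset.sum_le_sum fun x _ => by
          nlinarith [sq_sqrt (hp.nonneg x), sq_sqrt (hq.nonneg x),
            sq_nonneg (√(p.coeff x) - √(q.coeff x))]
      _ = 4 := by rw [← Finset.mul_sum, Finset.sum_add_distrib, hp1, hq1]; norm_num
  simp only [hsq]
  refine (Finset.sum_mul_sq_le_sq_mul_sq F _ _).trans ?_
  rw [mul_comm 4]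
  exact mul_le_mul hA hB (Finset.sum_nonneg fun _ _ => sq_nonneg _)
    ((Finset.sum_nonneg fun _ _ => sq_nonneg _).trans hA)

/-- Gibbs' inequality. -/
lemma IsProb.H_le {b : MonoidAlgebra ℝ G} (hb : IsProb b) {w : G → ℝ} (hw : ∀ x, 0 < w x) {C : ℝ}
    (hC : ∀ F : Finset G, ∑ x ∈ F, w x ≤ C) (hC0 : 0 < C) :
    H b ≤ expect (fun x => -log (w x)) b + log C := by
  have key : expect (fun x => log (w x) - log (b.coeff x) - log C) b ≤ 0 := by
    calc _ ≤ ∑ x ∈ b.coeff.support, (w x / C - b.coeff x) := by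
          rw [expect_eq_sum]
          refine Finset.sum_le_sum fun x hx => ?_
          have hx' : 0 < b.coeff x := hb.pos_of_ne (by simpa using hx)
          rw [sub_sub, ← log_mul hx'.ne' hC0.ne', ← log_div (hw x).ne' (by positivity)]
          calc _ ≤ b.coeff x * (w x / (b.coeff x * C) - 1) := by
                gcongr
                exact log_le_sub_one_of_pos (div_pos (hw x) (by positivity))
            _ = _ := by field_simp
      _ ≤ 0 := by
          rw [Finset.sum_sub_distrib, hb.sum_eq_one subset_rfl, ← Finset.sum_div, sub_nonpos,
            div_le_one hC0]
          exact hC _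
  rw [expect_fun_sub, hb.expect_const, expect_fun_sub] at key
  have h1 : H b = -expect (fun x => log (b.coeff x)) b := by
    simpa [H] using expect_fun_mul_left (-1) (fun x => log (b.coeff x)) b
  have h2 : expect (fun x => -log (w x)) b = -expect (fun x => log (w x)) b := by
    simpa using expect_fun_mul_left (-1) (fun x => log (w x)) b
  linarith

variable [Group G]

lemma coeff_mul_eq_expect (b c : MonoidAlgebra ℝ G) (x : G) :
    (b * c).coeff x = expect (fun s => c.coeff (s⁻¹ * x)) b :=
  MonoidAlgebra.coeff_mul_apply_left b c x

lemma coeff_mul_nonneg {b c : MonoidAlgebra ℝ G} (hb : ∀ x, 0 ≤ b.coeff x)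
    (hc : ∀ x, 0 ≤ c.coeff x) (x : G) : 0 ≤ (b * c).coeff x := by
  rw [coeff_mul_eq_expect]
  exact expect_nonneg hb fun _ _ => hc _

lemma IsProb.one : IsProb (1 : MonoidAlgebra ℝ G) := IsProb.single 1

lemma IsProb.mul {b c : MonoidAlgebra ℝ G} (hb : IsProb b) (hc : IsProb c) : IsProb (b * c) where
  nonneg := coeff_mul_nonneg hb.nonneg hc.nonneg
  total := by rw [expect_mul]; simp [hb.total, hc.total]

lemma IsProb.pow {b : MonoidAlgebra ℝ G} (hb : IsProb b) (n : ℕ) : IsProb (b ^ n) := by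
  induction n with
  | zero => simpa using IsProb.one
  | succ n ih => rw [pow_succ]; exact ih.mul hb

/-- One term of the convolution sum. It bounds the density of `δ_s * c` with respect to `b * c` by
`1 / b(s)`, the source of all upper bounds on `shiftKL`. -/
lemma mul_coeff_le_coeff_mul {b c : MonoidAlgebra ℝ G} (hb : ∀ x, 0 ≤ b.coeff x)
    (hc : ∀ x, 0 ≤ c.coeff x) (s z : G) : b.coeff s * c.coeff z ≤ (b * c).coeff (s * z) := by
  classical
  rw [coeff_mul_eq_expect, expect_eq_sum_of_subset _ b (Finset.subset_insert s _)]
  refine le_trans (le_of_eq ?_) (Finset.single_le_sum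
    (f := fun y => b.coeff y * c.coeff (y⁻¹ * (s * z)))
    (fun y _ => mul_nonneg (hb y) (hc _)) (Finset.mem_insert_self s _))
  simp

/-- The relative entropy of `δ_s * c` with respect to `q`. -/
def shiftKL (c q : MonoidAlgebra ℝ G) (s : G) : ℝ :=
  expect (fun z => log (c.coeff z) - log (q.coeff (s * z))) c

/-- Chain rule: the entropy gained by a factor `b` on the left is the mutual information between
that factor and the product. -/
lemma IsProb.H_mul {b : MonoidAlgebra ℝ G} (hb : IsProb b) (c : MonoidAlgebra ℝ G) :
    H (b * c) = H c + expect (shiftKL c (b * c)) b := by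
  have h : ∀ s, shiftKL c (b * c) s
      = expect (fun z => -log ((b * c).coeff (s * z))) c - H c := fun s => by
    rw [shiftKL, H, ← expect_fun_sub]; congr 1; ext z; ring
  rw [funext h, expect_fun_sub, hb.expect_const, ← expect_mul (fun y => -log ((b * c).coeff y))]
  rw [H, H]; ring

lemma IsProb.shiftKL_le_neg_log {b c : MonoidAlgebra ℝ G} (hb : IsProb b) (hc : IsProb c) {s : G}
    (hs : 0 < b.coeff s) : shiftKL c (b * c) s ≤ -log (b.coeff s) := by
  conv_rhs => rw [← hc.expect_const (-log (b.coeff s))]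
  refine expect_mono hc.nonneg fun z hz => ?_
  have := log_le_log (mul_pos hs hz) (mul_coeff_le_coeff_mul hb.nonneg hc.nonneg s z)
  rw [log_mul hs.ne' hz.ne'] at this
  linarith

lemma IsProb.H_mul_le {b c : MonoidAlgebra ℝ G} (hb : IsProb b) (hc : IsProb c) :
    H (b * c) ≤ H b + H c := by
  rw [hb.H_mul c, add_comm]
  gcongr
  exact expect_mono hb.nonneg fun s hs => hb.shiftKL_le_neg_log hc hs

lemma coeff_single_mul (s x : G) (c : MonoidAlgebra ℝ G) :
    (MonoidAlgebra.single s (1 : ℝ) * c).coeff x = c.coeff (s⁻¹ * x) := by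
  rw [MonoidAlgebra.coeff_single_mul_apply, one_mul]

/-- A reverse Pinsker inequality, linear in the `ℓ¹` distance. It is available because the density
ratio `r` is at most `1 / b(s)`, so that `r log r ≤ r (r - 1) ≤ |r - 1| / b(s)`. -/
lemma IsProb.shiftKL_le_l1 {b c : MonoidAlgebra ℝ G} (hb : IsProb b) (hc : IsProb c) {s : G}
    (hs : 0 < b.coeff s) :
    shiftKL c (b * c) s ≤ l1 (MonoidAlgebra.single s (1 : ℝ) * c - b * c) / b.coeff s := by
  classical
  set e := MonoidAlgebra.single s (1 : ℝ) * c - b * c with he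
  have hcoeff : ∀ z, e.coeff (s * z) = c.coeff z - (b * c).coeff (s * z) := fun z => by
    rw [he, MonoidAlgebra.coeff_sub, Finsupp.sub_apply, coeff_single_mul, inv_mul_cancel_left]
  calc shiftKL c (b * c) s
      ≤ ∑ z ∈ c.coeff.support, |e.coeff (s * z)| / b.coeff s := by
        rw [shiftKL, expect_eq_sum]
        refine Finset.sum_le_sum fun z hz => ?_
        have hz' : 0 < c.coeff z := hc.pos_of_ne (by simpa using hz)
        have hq := mul_coeff_le_coeff_mul hb.nonneg hc.nonneg s z
        have hq0 : 0 < (b * c).coeff (s * z) := (mul_pos hs hz').trans_le hq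
        rw [← log_div hz'.ne' hq0.ne', hcoeff]
        set q := (b * c).coeff (s * z)
        have h1 : log (c.coeff z / q) ≤ c.coeff z / q - 1 := log_le_sub_one_of_pos (by positivity)
        have h2 : c.coeff z / q ≤ 1 / b.coeff s := by
          rw [div_le_div_iff₀ hq0 hs]; linarith
        calc c.coeff z * log (c.coeff z / q) ≤ c.coeff z * (c.coeff z / q - 1) := by gcongr
          _ = c.coeff z / q * (c.coeff z - q) := by field_simp
          _ ≤ c.coeff z / q * |c.coeff z - q| := by
            gcongr; exact le_abs_self _
          _ ≤ 1 / b.coeff s * |c.coeff z - q| := by gcongr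
          _ = _ := by ring
    _ = (∑ y ∈ c.coeff.support.image (s * ·), |e.coeff y|) / b.coeff s := by
        rw [Finset.sum_image (by simp), Finset.sum_div]
    _ ≤ _ := by
        gcongr
        rw [l1_eq_sum_of_subset e (Finset.subset_union_right
          (s₁ := c.coeff.support.image (s * ·)))]
        exact Finset.sum_le_sum_of_subset_of_nonneg Finset.subset_union_left
          fun _ _ _ => abs_nonneg _

lemma IsProb.l1_sq_le_shiftKL {b c : MonoidAlgebra ℝ G} (hb : IsProb b) (hc : IsProb c) {s : G}
    (hs : 0 < b.coeff s) :
    l1 (MonoidAlgebra.single s (1 : ℝ) * c - b * c) ^ 2 ≤ 4 * shiftKL c (b * c) s := by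
  refine (((IsProb.single s).mul hc).l1_sq_le (hb.mul hc) fun x hx => ?_).trans_eq ?_
  · rw [coeff_single_mul] at hx
    have := mul_coeff_le_coeff_mul hb.nonneg hc.nonneg s (s⁻¹ * x)
    rw [mul_inv_cancel_left] at this
    exact (mul_pos hs hx).trans_le this
  · rw [expect_mul]
    simp [shiftKL]

end GroupWalk

end

/-! ### The Varopoulos–Carne bound via Chebyshev polynomials. -/

noncomputable section

namespace GroupWalk

open Real

variable {G : Type*}

/-- The squared `ℓ²` norm. -/
def normSq (b : MonoidAlgebra ℝ G) : ℝ := expect b.coeff b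

lemma normSq_eq_sum (b : MonoidAlgebra ℝ G) : normSq b = ∑ x ∈ b.coeff.support, b.coeff x ^ 2 :=
  Finset.sum_congr rfl fun _ _ => (sq _).symm

lemma sum_sq_le_normSq (b : MonoidAlgebra ℝ G) (F : Finset G) :
    ∑ x ∈ F, b.coeff x ^ 2 ≤ normSq b := by
  classical
  rw [normSq_eq_sum, ← Finset.sum_filter_add_sum_filter_not F (fun x => x ∈ b.coeff.support)]
  rw [Finset.sum_eq_zero (s := F.filter fun x => x ∉ b.coeff.support), add_zero]
  · exact Finset.sum_le_sum_of_subset_of_nonneg (fun x hx => (Finset.mem_filter.1 hx).2)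
      fun _ _ _ => sq_nonneg _
  · intro x hx
    have := (Finset.mem_filter.1 hx).2
    simp only [Finsupp.mem_support_iff, not_not] at this
    simp [this]

lemma IsProb.expect_sq_le {a : MonoidAlgebra ℝ G} (ha : IsProb a) (f : G → ℝ) :
    expect f a ^ 2 ≤ expect (fun x => f x ^ 2) a := by
  have h : 0 ≤ expect (fun x => (f x ^ 2 - 2 * expect f a * f x) + expect f a ^ 2) a :=
    expect_nonneg ha.nonneg fun x _ => by nlinarith [sq_nonneg (f x - expect f a)]
  rw [expect_fun_add, expect_fun_sub, expect_fun_mul_left, ha.expect_const] at h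
  nlinarith

variable [Group G]

/-- The involution `b ↦ (x ↦ b(x⁻¹))` of the group algebra. -/
def rev (b : MonoidAlgebra ℝ G) : MonoidAlgebra ℝ G :=
  .ofCoeff (b.coeff.equivMapDomain (Equiv.inv G))

@[simp] lemma coeff_rev (b : MonoidAlgebra ℝ G) (x : G) : (rev b).coeff x = b.coeff x⁻¹ := rfl

lemma rev_add (b c : MonoidAlgebra ℝ G) : rev (b + c) = rev b + rev c := by
  ext x; simp

lemma rev_single (x : G) (r : ℝ) :
    rev (MonoidAlgebra.single x r) = MonoidAlgebra.single x⁻¹ r := by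
  classical
  ext y
  simp only [coeff_rev, MonoidAlgebra.coeff_single, Finsupp.single_apply, inv_eq_iff_eq_inv]

lemma rev_zero : rev (0 : MonoidAlgebra ℝ G) = 0 := by ext x; simp

lemma rev_mul (b c : MonoidAlgebra ℝ G) : rev (b * c) = rev c * rev b := by
  induction b using MonoidAlgebra.induction_linear with
  | zero => simp [rev_zero]
  | add b b' h h' => rw [add_mul, rev_add, rev_add, mul_add, h, h']
  | single x r =>
    induction c using MonoidAlgebra.induction_linear with
    | zero => simp [rev_zero]
    | add c c' h h' => rw [mul_add, rev_add, rev_add, add_mul, h, h']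
    | single y t => simp [MonoidAlgebra.single_mul_single, rev_single, mul_comm]

lemma rev_smul (r : ℝ) (b : MonoidAlgebra ℝ G) : rev (r • b) = r • rev b := by
  ext x; simp

lemma rev_one : rev (1 : MonoidAlgebra ℝ G) = 1 := by
  rw [MonoidAlgebra.one_def, rev_single, inv_one]

lemma rev_pow {a : MonoidAlgebra ℝ G} (ha : rev a = a) (n : ℕ) : rev (a ^ n) = a ^ n := by
  induction n with
  | zero => simp [rev_one]
  | succ n ih => rw [pow_succ, rev_mul, ih, ha, ← pow_succ', pow_succ]

lemma rev_aeval {a : MonoidAlgebra ℝ G} (ha : rev a = a) (p : Polynomial ℝ) :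
    rev (Polynomial.aeval a p) = Polynomial.aeval a p := by
  induction p using Polynomial.induction_on' with
  | add p q hp hq => rw [map_add, rev_add, hp, hq]
  | monomial n r =>
    rw [Polynomial.aeval_monomial, ← Algebra.smul_def, rev_smul, rev_pow ha]

lemma normSq_eq_coeff_mul_self {b : MonoidAlgebra ℝ G} (hb : rev b = b) :
    normSq b = (b * b).coeff 1 := by
  rw [coeff_mul_eq_expect, normSq]
  congr 1
  ext x
  rw [mul_one, ← coeff_rev, hb]

/-- Convolution by a probability measure contracts the `ℓ²` norm. -/
lemma IsProb.normSq_mul_le {a : MonoidAlgebra ℝ G} (ha : IsProb a) (u : MonoidAlgebra ℝ G) :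
    normSq (a * u) ≤ normSq u := by
  classical
  rw [normSq_eq_sum]
  calc ∑ x ∈ (a * u).coeff.support, (a * u).coeff x ^ 2
      ≤ ∑ x ∈ (a * u).coeff.support, expect (fun s => u.coeff (s⁻¹ * x) ^ 2) a :=
        Finset.sum_le_sum fun x _ => by
          rw [coeff_mul_eq_expect]; exact ha.expect_sq_le _
    _ = expect (fun s => ∑ x ∈ (a * u).coeff.support, u.coeff (s⁻¹ * x) ^ 2) a := by
        simp only [expect_eq_sum, Finset.mul_sum]
        exact Finset.sum_comm
    _ ≤ expect (fun _ => normSq u) a := expect_mono ha.nonneg fun s _ => by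
        rw [← Finset.sum_image (s := (a * u).coeff.support) (g := fun x => s⁻¹ * x)
          (f := fun y => u.coeff y ^ 2) (by simp)]
        exact sum_sq_le_normSq u _
    _ = normSq u := ha.expect_const _

open Polynomial in
/-- Pell's equation for Chebyshev polynomials. -/
lemma chebyshev_pell (n : ℕ) :
    Chebyshev.T ℝ (n + 1) ^ 2 + (1 - X ^ 2) * Chebyshev.U ℝ n ^ 2 = 1 := by
  induction n with
  | zero => simp
  | succ n ih =>
    push_cast
    rw [show (n : ℤ) + 1 + 1 = n + 2 by ring, Chebyshev.T_eq_X_mul_T_sub_pol_U,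
      Chebyshev.U_eq_X_mul_U_add_T]
    linear_combination ih

/-- `T_k(a)`, for the Chebyshev polynomial `T_k`. -/
def cheb (a : MonoidAlgebra ℝ G) (k : ℤ) : MonoidAlgebra ℝ G :=
  Polynomial.aeval a (Polynomial.Chebyshev.T ℝ k)

/-- Replaces the spectral theorem and `|T_k| ≤ 1` on `[-1, 1]`. Pell's equation evaluated at `a`,
read at the coefficient of `1`, says `‖T‖² = 1 - ‖U‖² + ‖aU‖²`, and convolution by `a` is a
contraction. -/
lemma IsProb.normSq_cheb_le_one {a : MonoidAlgebra ℝ G} (ha : IsProb a) (hrev : rev a = a)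
    (k : ℤ) : normSq (cheb a k) ≤ 1 := by
  have h1 : ((1 : MonoidAlgebra ℝ G)).coeff 1 = 1 := MonoidAlgebra.coeff_one_one
  rw [cheb, ← Polynomial.Chebyshev.T_natAbs]
  rcases hk : k.natAbs with _ | n
  · simp [normSq_eq_coeff_mul_self (rev_one)]
  have hpell := congrArg (Polynomial.aeval a) (chebyshev_pell n)
  push_cast
  set t := Polynomial.aeval a (Polynomial.Chebyshev.T ℝ (n + 1)) with ht
  set u := Polynomial.aeval a (Polynomial.Chebyshev.U ℝ n) with hu
  have hcomm : a * u = u * a := by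
    have := congrArg (Polynomial.aeval a)
      (mul_comm Polynomial.X (Polynomial.Chebyshev.U ℝ n))
    simpa using this
  simp only [map_add, map_mul, map_sub, map_pow, map_one, Polynomial.aeval_X, ← ht, ← hu] at hpell
  have htt : t * t = 1 - u * u + (a * u) * (a * u) := by
    rw [show (a * u) * (a * u) = a ^ 2 * u ^ 2 by
      rw [mul_assoc, ← mul_assoc u a u, ← hcomm]; simp only [sq, mul_assoc]]
    rw [← hpell]; simp only [sub_mul, sq, one_mul]; abel
  have hrt : rev t = t := rev_aeval hrev _
  have hru : rev u = u := rev_aeval hrev _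
  have hrau : rev (a * u) = a * u := by rw [rev_mul, hrev, hru, hcomm]
  rw [normSq_eq_coeff_mul_self hrt, htt, MonoidAlgebra.coeff_add, MonoidAlgebra.coeff_sub,
    Finsupp.add_apply, Finsupp.sub_apply, h1, ← normSq_eq_coeff_mul_self hru,
    ← normSq_eq_coeff_mul_self hrau]
  linarith [ha.normSq_mul_le u]

lemma IsProb.abs_coeff_cheb_le_one {a : MonoidAlgebra ℝ G} (ha : IsProb a) (hrev : rev a = a)
    (k : ℤ) (x : G) : |(cheb a k).coeff x| ≤ 1 := by
  rw [← sq_le_one_iff_abs_le_one]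
  simpa using (sum_sq_le_normSq (cheb a k) {x}).trans (ha.normSq_cheb_le_one hrev k)

lemma coeff_pow_eq_zero {a : MonoidAlgebra ℝ G} {ℓ : G → ℕ} (h1 : ℓ 1 = 0)
    (hs : ∀ x s, a.coeff s ≠ 0 → ℓ (x * s) ≤ ℓ x + 1) (n : ℕ) {x : G} (hx : n < ℓ x) :
    (a ^ n).coeff x = 0 := by
  classical
  induction n generalizing x with
  | zero =>
    rw [pow_zero, MonoidAlgebra.one_def, MonoidAlgebra.coeff_single, Finsupp.single_apply,
      if_neg]
    rintro rfl
    omega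
  | succ n ih =>
    rw [pow_succ, MonoidAlgebra.coeff_mul_apply_right]
    refine Finset.sum_eq_zero fun s hs' => ?_
    have := hs (x * s⁻¹) s (by simpa using hs')
    rw [inv_mul_cancel_right] at this
    simp only [ih (x := x * s⁻¹) (by omega), zero_mul]

/-- Finite propagation: `T_k` has degree `|k|`, and each factor `a` moves the length up by at most
one. -/
lemma coeff_cheb_eq_zero {a : MonoidAlgebra ℝ G} {ℓ : G → ℕ} (h1 : ℓ 1 = 0)
    (hs : ∀ x s, a.coeff s ≠ 0 → ℓ (x * s) ≤ ℓ x + 1) (k : ℤ) {x : G} (hx : k.natAbs < ℓ x) :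
    (cheb a k).coeff x = 0 := by
  rw [cheb, Polynomial.aeval_eq_sum_range, MonoidAlgebra.coeff_sum, Finsupp.finsetSum_apply]
  refine Finset.sum_eq_zero fun i hi => ?_
  rw [Polynomial.Chebyshev.natDegree_T, Finset.mem_range] at hi
  rw [MonoidAlgebra.coeff_smul_apply, coeff_pow_eq_zero h1 hs i (by omega), smul_zero]

lemma mul_cheb (a : MonoidAlgebra ℝ G) (k : ℤ) :
    a * cheb a k = (2⁻¹ : ℝ) • (cheb a (k + 1) + cheb a (k - 1)) := by
  have h : Polynomial.X * Polynomial.Chebyshev.T ℝ k = (2⁻¹ : ℝ) •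
      (Polynomial.Chebyshev.T ℝ (k + 1) + Polynomial.Chebyshev.T ℝ (k - 1)) := by
    rw [Polynomial.Chebyshev.T_add_one, sub_add_cancel, mul_assoc, two_mul, ← two_smul ℝ, smul_smul]
    norm_num
  have := congrArg (Polynomial.aeval a) h
  simpa [cheb] using this

/-- The Varopoulos–Carne bound. -/
lemma IsProb.abs_coeff_pow_mul_cheb_le {a : MonoidAlgebra ℝ G} (ha : IsProb a) (hrev : rev a = a)
    {ℓ : G → ℕ} (h1 : ℓ 1 = 0) (hs : ∀ x s, a.coeff s ≠ 0 → ℓ (x * s) ≤ ℓ x + 1)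
    {t : ℝ} (ht : 0 ≤ t) (n : ℕ) (k : ℤ) (x : G) :
    |(a ^ n * cheb a k).coeff x| ≤ 2 * exp (-(t * ℓ x)) * cosh t ^ n * cosh (t * k) := by
  -- Multiplication by `a` acts on the index `k` of `T_k` as simple random walk on `ℤ`, for which
  -- `cosh (t * k)` is an eigenfunction with eigenvalue `cosh t`; hence the induction over all `k`
  -- at once. The base case combines `|T_k(a)(x)| ≤ 1` with its vanishing for `|k| < ℓ x`.
  induction n generalizing k with
  | zero =>
    rw [pow_zero, one_mul, pow_zero, mul_one]
    by_cases hk : k.natAbs < ℓ x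
    · rw [coeff_cheb_eq_zero h1 hs k hk, abs_zero]
      positivity
    · refine (ha.abs_coeff_cheb_le_one hrev k x).trans ?_
      have h2 : exp (t * |(k : ℝ)|) ≤ 2 * cosh (t * k) := by
        rw [← cosh_abs, abs_mul, abs_of_nonneg ht, cosh_eq]
        linarith [exp_pos (-(t * |(k : ℝ)|))]
      have h3 : (ℓ x : ℝ) ≤ |(k : ℝ)| := by
        rw [← Int.cast_abs, Int.abs_eq_natAbs]
        exact_mod_cast not_lt.1 hk
      calc (1 : ℝ) ≤ exp (-(t * ℓ x)) * exp (t * |(k : ℝ)|) := by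
            rw [← exp_add]
            exact one_le_exp (by nlinarith)
        _ ≤ exp (-(t * ℓ x)) * (2 * cosh (t * k)) := by gcongr
        _ = _ := by ring
  | succ n ih =>
    rw [pow_succ, mul_assoc, mul_cheb, mul_smul_comm, mul_add, MonoidAlgebra.coeff_smul_apply,
      MonoidAlgebra.coeff_add, Finsupp.add_apply, smul_eq_mul, abs_mul, abs_of_pos (by norm_num)]
    have h4 : cosh (t * (k + 1 : ℤ)) + cosh (t * (k - 1 : ℤ)) = 2 * (cosh t * cosh (t * k)) := by
      push_cast
      rw [mul_add, mul_sub, mul_one, cosh_add, cosh_sub]; ring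
    calc _ ≤ 2⁻¹ * (2 * exp (-(t * ℓ x)) * cosh t ^ n * cosh (t * (k + 1 : ℤ)) +
          2 * exp (-(t * ℓ x)) * cosh t ^ n * cosh (t * (k - 1 : ℤ))) := by
          gcongr
          exact (abs_add_le _ _).trans (add_le_add (ih _) (ih _))
      _ = _ := by rw [← mul_add, h4]; ring

lemma IsProb.coeff_pow_le {a : MonoidAlgebra ℝ G} (ha : IsProb a) (hrev : rev a = a)
    {ℓ : G → ℕ} (h1 : ℓ 1 = 0) (hs : ∀ x s, a.coeff s ≠ 0 → ℓ (x * s) ≤ ℓ x + 1)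
    {n : ℕ} (hn : n ≠ 0) (x : G) :
    (a ^ n).coeff x ≤ 2 * exp (-((ℓ x : ℝ) ^ 2 / (2 * n))) := by
  have hn' : (0 : ℝ) < n := by positivity
  -- The value `t = ℓ x / n` minimises the exponent `-t ℓ + n t² / 2` left after `cosh t ≤ exp(t² /
  -- 2)`.
  have h := ha.abs_coeff_pow_mul_cheb_le hrev h1 hs (t := ℓ x / n) (by positivity) n 0 x
  simp only [cheb, Polynomial.Chebyshev.T_zero, map_one, mul_one, Int.cast_zero, mul_zero,
    cosh_zero] at h
  refine (le_abs_self _).trans (h.trans ?_)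
  rw [mul_assoc]
  gcongr
  calc exp (-(ℓ x / n * ℓ x)) * cosh (ℓ x / n) ^ n
      ≤ exp (-(ℓ x / n * ℓ x)) * exp ((ℓ x / n) ^ 2 / 2) ^ n := by
        gcongr
        exact cosh_le_exp_half_sq _
    _ = _ := by
        rw [← exp_nat_mul, ← exp_add]
        congr 1
        field_simp
        ring

end GroupWalk

end

/-! ### Word length, step distributions, and comparison of speed with entropy. -/

noncomputable section

namespace GroupWalk

open Real

variable {G : Type*} [Group G]

section WordLength

variable {S : Finset G}

@[simp] lemma wordLength_one : wordLength S 1 = 0 := by simp [wordLength]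

lemma mulCayley_reachable_mul (x : G) {s : G} (hs : s ∈ S) :
    (SimpleGraph.mulCayley (S : Set G)).Reachable x (x * s) := by
  by_cases h : x = x * s
  · rw [← h]
  · exact SimpleGraph.Adj.reachable
      ((SimpleGraph.mulCayley_adj _ _ _).2 ⟨h, Or.inl (by simpa)⟩)

lemma mulCayley_reachable (hgen : Subgroup.closure (S : Set G) = ⊤) (x : G) :
    (SimpleGraph.mulCayley (S : Set G)).Reachable 1 x := by
  have hx : x ∈ Subgroup.closure (S : Set G) := hgen ▸ Subgroup.mem_top x
  induction hx using Subgroup.closure_induction_right with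
  | one => rfl
  | mul_right x hx s hs ih => exact ih.trans (mulCayley_reachable_mul x hs)
  | mul_inv_cancel x hx s hs ih =>
    refine ih.trans (SimpleGraph.Reachable.symm ?_)
    simpa using mulCayley_reachable_mul (x * s⁻¹) hs

lemma wordLength_mul_le_succ (hgen : Subgroup.closure (S : Set G) = ⊤) (x : G) {s : G}
    (hs : s ∈ S) : wordLength S (x * s) ≤ wordLength S x + 1 := by
  by_cases h : x = x * s
  · rw [← h]; omega
  · have hadj : (SimpleGraph.mulCayley (S : Set G)).Adj x (x * s) :=
      (SimpleGraph.mulCayley_adj _ _ _).2 ⟨h, Or.inl (by simpa)⟩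
    obtain ⟨p, hp⟩ := (mulCayley_reachable hgen x).exists_walk_length_eq_dist
    exact (SimpleGraph.dist_le (p.concat hadj)).trans (by simp [hp, wordLength])

lemma exists_eq_mul_of_wordLength_eq_succ (hsymm : ∀ s ∈ S, s⁻¹ ∈ S)
    (hgen : Subgroup.closure (S : Set G) = ⊤) {x : G} {k : ℕ} (hx : wordLength S x = k + 1) :
    ∃ y, ∃ s ∈ S, x = y * s ∧ wordLength S y = k := by
  -- The geodesic is taken from `x` to `1`, so that the last letter of `x` is its first edge and
  -- `cons` exposes it.
  obtain ⟨p, hp⟩ := (mulCayley_reachable hgen x).symm.exists_walk_length_eq_dist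
  rw [SimpleGraph.dist_comm] at hp
  change p.length = wordLength S x at hp
  rw [hx] at hp
  match p, hp with
  | .cons (v := y) hadj q, hq =>
    have hs : y⁻¹ * x ∈ S := by
      rcases ((SimpleGraph.mulCayley_adj _ _ _).1 hadj).2 with h | h
      · simpa using hsymm _ h
      · exact h
    have hle : wordLength S y ≤ k := by
      have h1 := SimpleGraph.dist_le q
      rw [SimpleGraph.dist_comm] at h1
      simp only [SimpleGraph.Walk.length_cons] at hq
      exact h1.trans (by omega)
    have h2 := wordLength_mul_le_succ hgen y hs
    rw [mul_inv_cancel_left, hx] at h2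
    exact ⟨y, y⁻¹ * x, hs, by group, by omega⟩

lemma wordLength_eq_zero (hgen : Subgroup.closure (S : Set G) = ⊤) {x : G}
    (hx : wordLength S x = 0) : x = 1 :=
  ((mulCayley_reachable hgen x).dist_eq_zero_iff.1 hx).symm

lemma wordLength_mul_le (hsymm : ∀ s ∈ S, s⁻¹ ∈ S)
    (hgen : Subgroup.closure (S : Set G) = ⊤) (x y : G) :
    wordLength S (x * y) ≤ wordLength S x + wordLength S y := by
  induction hk : wordLength S y generalizing y with
  | zero => simp [wordLength_eq_zero hgen hk]
  | succ k ih =>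
    obtain ⟨z, s, hs, rfl, hz⟩ := exists_eq_mul_of_wordLength_eq_succ hsymm hgen hk
    rw [← mul_assoc]
    have := wordLength_mul_le_succ hgen (x * z) hs
    have := ih z hz
    omega

end WordLength

/-- The uniform measure on `S`, as an element of the group algebra. -/
def srwStep (S : Finset G) : MonoidAlgebra ℝ G :=
  (S.card : ℝ)⁻¹ • ∑ s ∈ S, MonoidAlgebra.single s 1

/-- The step distribution of lazy random walk. -/
def lazyStep (S : Finset G) : MonoidAlgebra ℝ G := (2⁻¹ : ℝ) • (srwStep S + 1)

lemma coeff_srwStep [DecidableEq G] (S : Finset G) (x : G) :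
    (srwStep S).coeff x = if x ∈ S then (S.card : ℝ)⁻¹ else 0 := by
  rw [srwStep, MonoidAlgebra.coeff_smul_apply, MonoidAlgebra.coeff_sum, Finsupp.finsetSum_apply]
  simp [Finsupp.single_apply]

lemma coeff_lazyStep [DecidableEq G] (S : Finset G) (x : G) :
    (lazyStep S).coeff x = ((srwStep S).coeff x + if x = 1 then 1 else 0) / 2 := by
  rw [lazyStep, MonoidAlgebra.coeff_smul_apply, MonoidAlgebra.coeff_add, Finsupp.add_apply,
    MonoidAlgebra.one_def, MonoidAlgebra.coeff_single, Finsupp.single_apply, smul_eq_mul]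
  simp only [eq_comm (a := (1 : G))]
  ring

lemma srw_eq_coeff (S : Finset G) (x y : G) : srw S x y = (srwStep S).coeff (x⁻¹ * y) := by
  classical
  rw [srw, coeff_srwStep]; simp

lemma lazyRW_eq_coeff (S : Finset G) (x y : G) :
    lazyRW S x y = (lazyStep S).coeff (x⁻¹ * y) := by
  classical
  rw [lazyRW, coeff_lazyStep, srw_eq_coeff]
  simp [inv_mul_eq_one]

lemma expect_srwStep (S : Finset G) (f : G → ℝ) :
    expect f (srwStep S) = 1 / (S.card : ℝ) * ∑ s ∈ S, f s := by
  simp [srwStep, expect_smul, expect_sum]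

lemma expect_lazyStep (S : Finset G) (f : G → ℝ) :
    expect f (lazyStep S) = (expect f (srwStep S) + f 1) / 2 := by
  rw [lazyStep, expect_smul, expect_add, MonoidAlgebra.one_def, expect_single]; ring

/-- A symmetric probability measure on `S ∪ {1}` charging every point of `S`. -/
structure IsStep (S : Finset G) (a : MonoidAlgebra ℝ G) : Prop where
  isProb : IsProb a
  rev_eq : rev a = a
  mem_or_eq_one : ∀ s, a.coeff s ≠ 0 → s ∈ S ∨ s = 1
  pos : ∀ s ∈ S, 0 < a.coeff s

lemma isStep_srwStep {S : Finset G} (hne : S.Nonempty) (hsymm : ∀ s ∈ S, s⁻¹ ∈ S) :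
    IsStep S (srwStep S) := by
  classical
  have hd : (0 : ℝ) < S.card := by exact_mod_cast hne.card_pos
  have hmem : ∀ x, x⁻¹ ∈ S ↔ x ∈ S := fun x => ⟨fun h => by simpa using hsymm _ h, hsymm x⟩
  refine ⟨⟨fun x => ?_, ?_⟩, ?_, fun s hs => ?_, fun s hs => ?_⟩
  · rw [coeff_srwStep]; split_ifs <;> positivity
  · rw [expect_srwStep]; simp [hd.ne']
  · ext x; rw [coeff_rev, coeff_srwStep, coeff_srwStep]; simp [hmem]
  · rw [coeff_srwStep] at hs; left; by_contra h; simp [h] at hs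
  · rw [coeff_srwStep, if_pos hs]; positivity

lemma isStep_lazyStep {S : Finset G} (hne : S.Nonempty) (hsymm : ∀ s ∈ S, s⁻¹ ∈ S) :
    IsStep S (lazyStep S) := by
  classical
  have h := isStep_srwStep hne hsymm
  refine ⟨⟨fun x => ?_, ?_⟩, ?_, fun s hs => ?_, fun s hs => ?_⟩
  · have := h.isProb.nonneg x
    rw [coeff_lazyStep]; split_ifs <;> positivity
  · rw [expect_lazyStep, h.isProb.total]; norm_num
  · rw [lazyStep, rev_smul, rev_add, h.rev_eq, rev_one]
  · rw [coeff_lazyStep] at hs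
    by_cases h1 : s = 1
    · exact Or.inr h1
    · exact h.mem_or_eq_one s fun h0 => hs (by simp [h0, h1])
  · have := h.pos s hs
    rw [coeff_lazyStep]; split_ifs <;> positivity

lemma exists_tendsto_div_of_subadditive {u : ℕ → ℝ} (hu : Subadditive u) (h0 : ∀ n, 0 ≤ u n) :
    ∃ l, Tendsto (fun n => u n / n) atTop (𝓝 l) ∧ ∀ n ≠ 0, l ≤ u n / n := by
  have hbdd : BddBelow (Set.range fun n => u n / n) :=
    ⟨0, by rintro _ ⟨n, rfl⟩; exact div_nonneg (h0 n) n.cast_nonneg⟩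
  exact ⟨hu.lim, hu.tendsto_lim hbdd, fun n hn => hu.lim_le_div hbdd hn⟩

variable {S : Finset G} {a : MonoidAlgebra ℝ G}

lemma IsStep.subadditive_H (ha : IsStep S a) : Subadditive fun n => H (a ^ n) := fun m n => by
  beta_reduce
  rw [pow_add]; exact (ha.isProb.pow m).H_mul_le (ha.isProb.pow n)

/-- The mean word length under a finitely supported measure. -/
def meanLength (S : Finset G) (b : MonoidAlgebra ℝ G) : ℝ :=
  expect (fun x => (wordLength S x : ℝ)) b

lemma IsProb.meanLength_nonneg {b : MonoidAlgebra ℝ G} (hb : IsProb b) : 0 ≤ meanLength S b :=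
  expect_nonneg hb.nonneg fun _ _ => Nat.cast_nonneg _

lemma IsProb.meanLength_mul_le (hsymm : ∀ s ∈ S, s⁻¹ ∈ S)
    (hgen : Subgroup.closure (S : Set G) = ⊤) {b c : MonoidAlgebra ℝ G} (hb : IsProb b)
    (hc : IsProb c) : meanLength S (b * c) ≤ meanLength S b + meanLength S c := by
  rw [meanLength, expect_mul]
  calc _ ≤ expect (fun x => expect (fun y => (wordLength S x : ℝ) + wordLength S y) c) b :=
        expect_mono hb.nonneg fun x _ => expect_mono hc.nonneg fun y _ => by
          exact_mod_cast wordLength_mul_le hsymm hgen x y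
    _ = _ := by
        simp only [expect_fun_add, hc.expect_const, hb.expect_const]; rfl

lemma IsStep.subadditive_meanLength (hsymm : ∀ s ∈ S, s⁻¹ ∈ S)
    (hgen : Subgroup.closure (S : Set G) = ⊤) (ha : IsStep S a) :
    Subadditive fun n => meanLength S (a ^ n) := fun m n => by
  beta_reduce
  rw [pow_add]; exact (ha.isProb.pow m).meanLength_mul_le hsymm hgen (ha.isProb.pow n)

lemma IsStep.wordLength_mul_le_succ (hgen : Subgroup.closure (S : Set G) = ⊤) (ha : IsStep S a)
    (x s : G) (hs : a.coeff s ≠ 0) : wordLength S (x * s) ≤ wordLength S x + 1 := by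
  rcases ha.mem_or_eq_one s hs with h | rfl
  · exact GroupWalk.wordLength_mul_le_succ hgen x h
  · simp

lemma inv_card_pow_le_coeff_srwStep_pow (hne : S.Nonempty) (hsymm : ∀ s ∈ S, s⁻¹ ∈ S)
    (hgen : Subgroup.closure (S : Set G) = ⊤) (x : G) :
    (S.card : ℝ)⁻¹ ^ wordLength S x ≤ (srwStep S ^ wordLength S x).coeff x := by
  classical
  have hp := isStep_srwStep hne hsymm
  induction hk : wordLength S x generalizing x with
  | zero => simp [wordLength_eq_zero hgen hk, MonoidAlgebra.one_def]
  | succ k ih =>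
    obtain ⟨y, s, hs, rfl, hy⟩ := exists_eq_mul_of_wordLength_eq_succ hsymm hgen hk
    rw [pow_succ, pow_succ]
    refine le_trans ?_ (mul_coeff_le_coeff_mul (hp.isProb.pow k).nonneg hp.isProb.nonneg y s)
    rw [coeff_srwStep, if_pos hs]
    gcongr
    exact ih y hy

/-- If `|x| = k`, following a geodesic shows that `k` steps of simple random walk reach `x` with
probability at least `d^(-k)`. So the weight is dominated by `∑ 2^(-k) p^k`, of total mass at most
`2`. -/
lemma sum_inv_pow_wordLength_le (hne : S.Nonempty) (hsymm : ∀ s ∈ S, s⁻¹ ∈ S)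
    (hgen : Subgroup.closure (S : Set G) = ⊤) (F : Finset G) :
    ∑ x ∈ F, (2 * (S.card : ℝ))⁻¹ ^ wordLength S x ≤ 2 := by
  classical
  have hp := (isStep_srwStep hne hsymm).isProb
  set N := F.sup (wordLength S) + 1
  calc _ ≤ ∑ x ∈ F, ∑ k ∈ Finset.range N, (1 / 2 : ℝ) ^ k * (srwStep S ^ k).coeff x := by
        refine Finset.sum_le_sum fun x hx => ?_
        have hmem : wordLength S x ∈ Finset.range N :=
          Finset.mem_range.2 (Nat.lt_succ_of_le (Finset.le_sup hx))
        refine le_trans ?_ (Finset.single_le_sum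
          (f := fun k => (1 / 2 : ℝ) ^ k * (srwStep S ^ k).coeff x)
          (fun k _ => mul_nonneg (by positivity) ((hp.pow k).nonneg x)) hmem)
        rw [mul_inv, mul_pow, inv_eq_one_div]
        gcongr
        exact inv_card_pow_le_coeff_srwStep_pow hne hsymm hgen x
    _ = ∑ k ∈ Finset.range N, (1 / 2 : ℝ) ^ k * ∑ x ∈ F, (srwStep S ^ k).coeff x := by
        rw [Finset.sum_comm]; simp only [Finset.mul_sum]
    _ ≤ ∑ k ∈ Finset.range N, (1 / 2 : ℝ) ^ k := by
        refine Finset.sum_le_sum fun k _ => mul_le_of_le_one_right (by positivity) ?_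
        rw [← (hp.pow k).sum_eq_one (Finset.subset_union_right (s₁ := F))]
        exact Finset.sum_le_sum_of_subset_of_nonneg Finset.subset_union_left
          fun x _ _ => (hp.pow k).nonneg x
    _ ≤ 2 := sum_geometric_two_le N

lemma IsProb.H_le_meanLength (hne : S.Nonempty) (hsymm : ∀ s ∈ S, s⁻¹ ∈ S)
    (hgen : Subgroup.closure (S : Set G) = ⊤) {b : MonoidAlgebra ℝ G} (hb : IsProb b) :
    H b ≤ log (2 * S.card) * meanLength S b + log 2 := by
  have hd : (0 : ℝ) < S.card := by exact_mod_cast hne.card_pos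
  refine (hb.H_le (w := fun x => (2 * (S.card : ℝ))⁻¹ ^ wordLength S x) (fun x => by positivity)
    (sum_inv_pow_wordLength_le hne hsymm hgen) two_pos).trans_eq ?_
  rw [meanLength, ← expect_fun_mul_left]
  congr 2
  ext x
  rw [log_pow, log_inv]; ring

/-- Varopoulos–Carne bounds `-log (a ^ n)(x)` below by `|x|² / 2n - log 2`; average this and use
Jensen for the square. -/
lemma IsStep.meanLength_sq_le (hgen : Subgroup.closure (S : Set G) = ⊤) (ha : IsStep S a)
    {n : ℕ} (hn : n ≠ 0) :
    meanLength S (a ^ n) ^ 2 / (2 * n) - log 2 ≤ H (a ^ n) := by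
  have hp := ha.isProb.pow n
  calc _ ≤ expect (fun x => (2 * n : ℝ)⁻¹ * (wordLength S x : ℝ) ^ 2 - log 2) (a ^ n) := by
        rw [expect_fun_sub, hp.expect_const, expect_fun_mul_left, div_eq_inv_mul]
        gcongr
        exact hp.expect_sq_le _
    _ ≤ H (a ^ n) := expect_mono hp.nonneg fun x hx => by
        have h := log_le_log hx (ha.isProb.coeff_pow_le ha.rev_eq (wordLength_one (S := S))
          (fun x s => ha.wordLength_mul_le_succ hgen x s) hn x)
        rw [log_mul (by norm_num) (exp_pos _).ne', log_exp, div_eq_inv_mul] at h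
        linarith

/-- The speed is positive if and only if the asymptotic entropy is. -/
lemma IsStep.speed_pos_iff_entropy_pos (hne : S.Nonempty) (hsymm : ∀ s ∈ S, s⁻¹ ∈ S)
    (hgen : Subgroup.closure (S : Set G) = ⊤) (ha : IsStep S a) {v h : ℝ}
    (hv : Tendsto (fun n : ℕ => meanLength S (a ^ n) / n) atTop (𝓝 v))
    (hh : Tendsto (fun n : ℕ => H (a ^ n) / n) atTop (𝓝 h)) : 0 < v ↔ 0 < h := by
  have hd : (1 : ℝ) ≤ S.card := by exact_mod_cast hne.card_pos
  have hlog : Tendsto (fun n : ℕ => log 2 / n) atTop (𝓝 0) :=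
    tendsto_const_div_atTop_nhds_zero_nat _
  have hv0 : 0 ≤ v := ge_of_tendsto' hv fun n =>
    div_nonneg (ha.isProb.pow n).meanLength_nonneg n.cast_nonneg
  -- Dividing the two entropy bounds by `n` yields `v² / 2 ≤ h ≤ v log(2d)`.
  have h1 : v ^ 2 / 2 - 0 ≤ h := by
    refine le_of_tendsto_of_tendsto (((hv.pow 2).div_const 2).sub hlog) hh ?_
    filter_upwards [eventually_ne_atTop 0] with n hn
    have hn' : (0 : ℝ) < n := by positivity
    calc _ = (meanLength S (a ^ n) ^ 2 / (2 * n) - log 2) / n := by field_simp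
      _ ≤ _ := by gcongr; exact ha.meanLength_sq_le hgen hn
  have h2 : h ≤ log (2 * S.card) * v + 0 := by
    refine le_of_tendsto_of_tendsto hh ((hv.const_mul _).add hlog) ?_
    filter_upwards with n
    calc _ ≤ (log (2 * S.card) * meanLength S (a ^ n) + log 2) / n := by
          gcongr; exact (ha.isProb.pow n).H_le_meanLength hne hsymm hgen
      _ = _ := by ring
  constructor
  · intro h3; have := pow_pos h3 2; linarith
  · intro h3
    refine hv0.lt_of_ne fun h4 => ?_
    rw [← h4, mul_zero] at h2
    linarith

end GroupWalk

end

/-! ### Entropy and bounded harmonic functions. -/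

noncomputable section

namespace GroupWalk

open Real

lemma abs_sign_le_one (r : ℝ) : |(SignType.sign r : ℝ)| ≤ 1 := by
  rcases lt_trichotomy r 0 with h | h | h
  · simp [sign_neg h]
  · simp [h]
  · simp [sign_pos h]

/-- Telescoping. Used by contradiction, it finds times with small or large entropy increment without
knowing that the increments are monotone. -/
lemma le_of_tendsto_div_of_eventually_diff_le {u : ℕ → ℝ} {l c : ℝ}
    (hu : Tendsto (fun n : ℕ => u n / n) atTop (𝓝 l))
    (hc : ∀ᶠ n in atTop, u (n + 1) - u n ≤ c) : l ≤ c := by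
  obtain ⟨N, hN⟩ := eventually_atTop.1 hc
  have hle : ∀ n ≥ N, u n ≤ u N + c * (n - N) := fun n hn => by
    induction n, hn using Nat.le_induction with
    | base => simp
    | succ n hn ih => push_cast; linarith [hN n hn]
  have hlim : Tendsto (fun n : ℕ => (u N - c * N) / n + c) atTop (𝓝 (0 + c)) :=
    (tendsto_const_div_atTop_nhds_zero_nat _).add tendsto_const_nhds
  rw [zero_add] at hlim
  refine le_of_tendsto_of_tendsto hu hlim ?_
  filter_upwards [eventually_ge_atTop N, eventually_ne_atTop 0] with n hn hn0
  have hn' : (0 : ℝ) < n := by positivity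
  rw [div_add' _ _ _ hn'.ne']
  gcongr
  linarith [hle n hn]

lemma le_of_tendsto_div_of_eventually_le_diff {u : ℕ → ℝ} {l c : ℝ}
    (hu : Tendsto (fun n : ℕ => u n / n) atTop (𝓝 l))
    (hc : ∀ᶠ n in atTop, c ≤ u (n + 1) - u n) : c ≤ l := by
  have := le_of_tendsto_div_of_eventually_diff_le (u := fun n => -u n) (l := -l) (c := -c)
    (by simpa only [neg_div] using hu.neg) (hc.mono fun n hn => by linarith)
  linarith

variable {G : Type*} [Group G] {S : Finset G} {a : MonoidAlgebra ℝ G}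

lemma isHarmonic_iff_srwStep {u : G → ℝ} :
    IsHarmonic S u ↔ ∀ x, expect (fun s => u (x * s)) (srwStep S) = u x := by
  simp only [IsHarmonic, expect_srwStep, eq_comm]

lemma isHarmonic_iff_lazyStep {u : G → ℝ} :
    IsHarmonic S u ↔ ∀ x, expect (fun s => u (x * s)) (lazyStep S) = u x := by
  rw [isHarmonic_iff_srwStep]
  refine forall_congr' fun x => ?_
  rw [expect_lazyStep, mul_one]
  constructor <;> intro h <;> linarith

lemma expect_pow_eq_of_harmonic {u : G → ℝ} (hu : ∀ x, expect (fun s => u (x * s)) a = u x)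
    (n : ℕ) (x : G) : expect (fun y => u (x * y)) (a ^ n) = u x := by
  induction n generalizing x with
  | zero => simp [MonoidAlgebra.one_def]
  | succ n ih =>
    rw [pow_succ, expect_mul]
    simp only [← mul_assoc, hu]
    exact ih x

lemma IsProb.H_pow_succ (ha : IsProb a) (n : ℕ) :
    H (a ^ (n + 1)) - H (a ^ n) = expect (shiftKL (a ^ n) (a * a ^ n)) a := by
  rw [pow_succ', ha.H_mul]; ring

/-- The increment averages nonnegative relative entropies, hence dominates each weighted term;
Pinsker then applies to the term of `s`. -/
lemma IsProb.mul_l1_sq_le (ha : IsProb a) (n : ℕ) {s : G} (hs : 0 < a.coeff s) :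
    a.coeff s * l1 (MonoidAlgebra.single s (1 : ℝ) * a ^ n - a * a ^ n) ^ 2
      ≤ 4 * (H (a ^ (n + 1)) - H (a ^ n)) := by
  have hn := ha.pow n
  rw [ha.H_pow_succ, expect_eq_sum]
  have h0 : ∀ t ∈ a.coeff.support, 0 ≤ a.coeff t * shiftKL (a ^ n) (a * a ^ n) t := fun t ht => by
    have ht' : 0 < a.coeff t := ha.pos_of_ne (by simpa using ht)
    have := ha.l1_sq_le_shiftKL hn ht'
    have := sq_nonneg (l1 (MonoidAlgebra.single t (1 : ℝ) * a ^ n - a * a ^ n))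
    exact mul_nonneg ht'.le (by linarith)
  have h1 := Finset.single_le_sum h0 (Finsupp.mem_support_iff.2 hs.ne')
  have h2 := mul_le_mul_of_nonneg_left (ha.l1_sq_le_shiftKL hn hs) hs.le
  linarith

/-- If the asymptotic entropy vanishes, bounded harmonic functions are constant. -/
lemma IsStep.eq_of_harmonic_of_entropy_eq_zero (hgen : Subgroup.closure (S : Set G) = ⊤)
    (ha : IsStep S a) (hh : Tendsto (fun n : ℕ => H (a ^ n) / n) atTop (𝓝 0)) {u : G → ℝ} {C : ℝ}
    (hC : ∀ x, |u x| ≤ C) (hu : ∀ x, expect (fun s => u (x * s)) a = u x) (x : G) :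
    u x = u 1 := by
  have key : ∀ s ∈ S, ∀ x, u (x * s) = u x := fun s hs x => by
    have has := ha.pos s hs
    rw [← sub_eq_zero, ← sq_eq_zero_iff]
    refine le_antisymm (le_of_forall_pos_le_add fun ε hε => ?_) (sq_nonneg _)
    -- Chosen so that an increment below `δ` forces `l1 e ^ 2 ≤ ε / (C² + 1)`; the `+ 1` keeps the
    -- denominator nonzero when `C = 0`.
    set δ := ε * a.coeff s / (4 * (C ^ 2 + 1)) with hδ
    have hδ0 : 0 < δ := by positivity
    obtain ⟨n, hn⟩ : ∃ n, H (a ^ (n + 1)) - H (a ^ n) < δ := by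
      by_contra! hcon
      exact absurd (le_of_tendsto_div_of_eventually_le_diff hh (Eventually.of_forall hcon))
        (not_le.2 hδ0)
    have h1 := ha.isProb.mul_l1_sq_le n has
    set e := MonoidAlgebra.single s (1 : ℝ) * a ^ n - a * a ^ n with he
    -- By harmonicity `u (x * s)` is the mean of `u (x * ·)` under `δ_s * a ^ n`, and `u x` is its
    -- mean under `a ^ (n+1)`.
    have h2 : u (x * s) - u x = expect (fun y => u (x * y)) e := by
      rw [he, expect_sub, ← pow_succ', expect_pow_eq_of_harmonic hu, expect_mul, expect_single]
      simp only [← mul_assoc]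
      rw [one_mul, expect_pow_eq_of_harmonic hu]
    have h3 : |u (x * s) - u x| ≤ C * l1 e := by
      rw [h2]; exact abs_expect_le (fun y => hC _) e
    have h4 : (u (x * s) - u x) ^ 2 ≤ C ^ 2 * l1 e ^ 2 := by
      rw [← sq_abs, ← mul_pow]; gcongr
    have h5 : l1 e ^ 2 ≤ ε / (C ^ 2 + 1) := by
      have h6 : a.coeff s * l1 e ^ 2 ≤ a.coeff s * (ε / (C ^ 2 + 1)) := by
        calc _ ≤ 4 * δ := by linarith
          _ = _ := by rw [hδ]; field_simp
      exact le_of_mul_le_mul_left h6 has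
    calc _ ≤ C ^ 2 * (ε / (C ^ 2 + 1)) := h4.trans (by gcongr)
      _ ≤ 0 + ε := by
        rw [zero_add, ← mul_div_assoc, div_le_iff₀ (by positivity)]
        nlinarith
  have hx : x ∈ Subgroup.closure (S : Set G) := hgen ▸ Subgroup.mem_top x
  induction hx using Subgroup.closure_induction_right with
  | one => rfl
  | mul_right x hx s hs ih => rw [key s hs, ih]
  | mul_inv_cancel x hx s hs ih => rw [← ih, ← key s hs (x * s⁻¹), inv_mul_cancel_right]

/-- If the entropy is positive and the convolution powers are asymptotically invariant, there is
a non-constant bounded harmonic function. -/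
lemma IsProb.exists_harmonic_of_entropy_pos (ha : IsProb a) {h : ℝ} (h0 : 0 < h)
    (hh : Tendsto (fun n : ℕ => H (a ^ n) / n) atTop (𝓝 h))
    (hl1 : Tendsto (fun n : ℕ => l1 (a ^ n - a ^ (n + 1))) atTop (𝓝 0)) :
    ∃ u : G → ℝ, (∀ x, |u x| ≤ 1) ∧ (∀ x, expect (fun s => u (x * s)) a = u x) ∧
      ∃ x y, u x ≠ u y := by
  set e : ℕ → G → MonoidAlgebra ℝ G :=
    fun n s => MonoidAlgebra.single s (1 : ℝ) * a ^ n - a * a ^ n with he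
  -- Otherwise, the support being finite, eventually every `shiftKL` is at most `h / 2` by the
  -- reverse Pinsker bound, and then so is the limit `h`.
  obtain ⟨s, hs, hfreq⟩ : ∃ s ∈ a.coeff.support, ∃ᶠ n in atTop, a.coeff s * (h / 2) ≤ l1 (e n s) := by
    by_contra! hcon
    have hev := (eventually_all_finset _).2 hcon
    have := le_of_tendsto_div_of_eventually_diff_le hh (c := h / 2) <| hev.mono fun n hn => by
      rw [ha.H_pow_succ, ← ha.expect_const (h / 2)]
      refine expect_mono ha.nonneg fun s hs => (ha.shiftKL_le_l1 (ha.pow n) hs).trans ?_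
      rw [div_le_iff₀' hs]
      exact (hn s (Finsupp.mem_support_iff.2 hs.ne')).le
    linarith
  have has : 0 < a.coeff s := ha.pos_of_ne (by simpa using hs)
  -- An ultrafilter concentrated on the times that remember `s` makes all the bounded sequences `w n
  -- x` converge at once.
  obtain ⟨U, hU⟩ : ∃ U : Ultrafilter ℕ,
      (U : Filter ℕ) ≤ atTop ⊓ 𝓟 {n | a.coeff s * (h / 2) ≤ l1 (e n s)} := by
    have : (atTop ⊓ 𝓟 {n | a.coeff s * (h / 2) ≤ l1 (e n s)}).NeBot :=
      frequently_mem_iff_neBot.1 hfreq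
    exact ⟨Ultrafilter.of _, Ultrafilter.of_le _⟩
  have hUtop : (U : Filter ℕ) ≤ atTop := hU.trans inf_le_left
  have hUs : ∀ᶠ n in (U : Filter ℕ), a.coeff s * (h / 2) ≤ l1 (e n s) :=
    le_principal_iff.1 (hU.trans inf_le_right)
  -- The sign of `e n s` is the test function whose integral against `e n s` equals its `ℓ¹` norm.
  set f : ℕ → G → ℝ := fun n y => (SignType.sign ((e n s).coeff y) : ℝ) with hf
  have hf1 : ∀ n y, |f n y| ≤ 1 := fun n y => abs_sign_le_one _
  set w : ℕ → G → ℝ := fun n x => expect (fun y => f n (x * y)) (a ^ n) with hw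
  have hw1 : ∀ n x, |w n x| ≤ 1 := fun n x => (ha.pow n).abs_expect_le fun y => hf1 n _
  have hlim : ∀ x, ∃ l, |l| ≤ 1 ∧ Tendsto (fun n => w n x) U (𝓝 l) := fun x => by
    obtain ⟨l, hl, hl'⟩ := (isCompact_Icc (a := (-1 : ℝ)) (b := 1)).ultrafilter_le_nhds
      (U.map fun n => w n x) (le_principal_iff.2 (mem_map.2
        (univ_mem' fun n => abs_le.1 (hw1 n x))))
    exact ⟨l, abs_le.2 hl, hl'⟩
  choose u hu1 hu using hlim
  have hPw : ∀ n x, expect (fun t => w n (x * t)) a = expect (fun y => f n (x * y)) (a * a ^ n) :=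
    fun n x => by rw [expect_mul]; simp only [hw, mul_assoc]
  have hPlim : ∀ x, Tendsto (fun n => expect (fun t => w n (x * t)) a) U
      (𝓝 (expect (fun t => u (x * t)) a)) := fun x => by
    simp only [expect_eq_sum]
    exact tendsto_finsetSum _ fun t _ => (hu (x * t)).const_mul _
  have hharm : ∀ x, expect (fun t => u (x * t)) a = u x := fun x => by
    have hsub : Tendsto (fun n => w n x - expect (fun t => w n (x * t)) a) U (𝓝 0) := by
      refine squeeze_zero_norm (fun n => ?_) (hl1.mono_left hUtop)
      rw [hPw, hw, ← expect_sub, ← pow_succ', Real.norm_eq_abs]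
      simpa using GroupWalk.abs_expect_le (fun y => hf1 n (x * y)) (a ^ n - a ^ (n + 1))
    have := tendsto_nhds_unique hsub ((hu x).sub (hPlim x))
    linarith
  refine ⟨u, hu1, hharm, s, 1, fun heq => ?_⟩
  -- The difference `w n s - (P w n)(1)` is exactly the `ℓ¹` norm of `e n s`, which stays away from
  -- `0` along `U`.
  have hsub : Tendsto (fun n => w n s - expect (fun t => w n (1 * t)) a) U (𝓝 (u s - u 1)) := by
    rw [← hharm 1]; exact (hu s).sub (hPlim 1)
  have hge : a.coeff s * (h / 2) ≤ u s - u 1 := by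
    refine ge_of_tendsto hsub (hUs.mono fun n hn => hn.trans_eq ?_)
    rw [hPw, hw, ← expect_sign_eq_l1]
    simp only [he, expect_sub, one_mul]
    rw [expect_mul, expect_single, one_mul]
  rw [heq, sub_self] at hge
  have : 0 < a.coeff s * (h / 2) := by positivity
  linarith

/-! ### Lazy walk as simple random walk at a binomial time. -/

section Binomial

/-- The binomial distribution with parameter `1/2`. -/
def binom (n j : ℕ) : ℝ := (n.choose j : ℝ) / 2 ^ n

lemma binom_nonneg (n j : ℕ) : 0 ≤ binom n j := by unfold binom; positivity

lemma eval_bernsteinPolynomial_half {n j : ℕ} (hj : j ∈ Finset.range (n + 1)) :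
    (bernsteinPolynomial ℝ n j).eval (1 / 2) = binom n j := by
  have hj' : j ≤ n := Nat.lt_succ_iff.1 (Finset.mem_range.1 hj)
  simp only [bernsteinPolynomial, binom, Polynomial.eval_mul, Polynomial.eval_natCast,
    Polynomial.eval_pow, Polynomial.eval_X, Polynomial.eval_sub, Polynomial.eval_one]
  rw [show (1 : ℝ) - 1 / 2 = 1 / 2 by norm_num, mul_assoc, ← pow_add, Nat.add_sub_cancel' hj',
    one_div, inv_pow, div_eq_mul_inv]

lemma sum_binom (n : ℕ) : ∑ j ∈ Finset.range (n + 1), binom n j = 1 := by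
  have h := congrArg (Polynomial.eval (1 / 2)) (bernsteinPolynomial.sum ℝ n)
  rw [Polynomial.eval_finsetSum, Polynomial.eval_one] at h
  rw [← h]
  exact Finset.sum_congr rfl fun j hj => (eval_bernsteinPolynomial_half hj).symm

lemma sum_mul_binom (n : ℕ) : ∑ j ∈ Finset.range (n + 1), (j : ℝ) * binom n j = n / 2 := by
  have h := congrArg (Polynomial.eval (1 / 2)) (bernsteinPolynomial.sum_smul ℝ n)
  rw [Polynomial.eval_finsetSum, Polynomial.eval_smul, Polynomial.eval_X] at h
  rw [Finset.sum_congr (s₂ := Finset.range (n + 1)) (g := fun j =>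
    (j : ℝ) * (bernsteinPolynomial ℝ n j).eval (1 / 2)) rfl
    fun j hj => by rw [eval_bernsteinPolynomial_half hj]]
  simpa [div_eq_mul_inv] using h

lemma sum_sq_mul_binom (n : ℕ) :
    ∑ j ∈ Finset.range (n + 1), ((n : ℝ) - 2 * (j : ℝ)) ^ 2 * binom n j = (n : ℝ) := by
  have h := congrArg (Polynomial.eval (1 / 2)) (bernsteinPolynomial.variance ℝ n)
  rw [Polynomial.eval_finsetSum] at h
  rw [Finset.sum_congr (s₂ := Finset.range (n + 1)) (g := fun j =>
    ((n : ℝ) - 2 * j) ^ 2 * (bernsteinPolynomial ℝ n j).eval (1 / 2)) rfl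
    fun j hj => by rw [eval_bernsteinPolynomial_half hj]]
  simp only [Polynomial.eval_mul, Polynomial.eval_pow, Polynomial.eval_sub,
    Polynomial.eval_X, Polynomial.eval_natCast, Polynomial.eval_one, nsmul_eq_mul] at h
  have h2 : ∀ j : ℕ, ((n : ℝ) - 2 * j) ^ 2 * (bernsteinPolynomial ℝ n j).eval (1 / 2)
      = 4 * (((n : ℝ) * (1 / 2) - j) ^ 2 * (bernsteinPolynomial ℝ n j).eval (1 / 2)) :=
    fun j => by ring
  simp only [h2]
  rw [← Finset.mul_sum, h]; ring

lemma binom_sub_binom_succ {n j : ℕ} (hj : j ≤ n + 1) :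
    binom n j - binom (n + 1) j
      = ((n + 1 : ℕ) - 2 * j : ℝ) * binom (n + 1) j / (n + 1 : ℕ) := by
  have h : (n.choose j : ℝ) * (n + 1 : ℕ) = (n + 1).choose j * ((n + 1 : ℕ) - j) := by
    rw [← Nat.cast_sub hj]
    exact_mod_cast Nat.choose_mul_succ_eq n j
  unfold binom
  have hn : ((n + 1 : ℕ) : ℝ) ≠ 0 := by positivity
  field_simp
  rw [pow_succ]
  linear_combination 2 * 2 ^ n * h

/-- With `J` binomial of parameters `n + 1` and `1/2`, the sum is `E|n + 1 - 2J| / (n + 1)`;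
Cauchy–Schwarz and the variance bound it by `(n + 1)^(-1/2)`. -/
lemma sum_abs_binom_sub_le (n : ℕ) :
    ∑ j ∈ Finset.range (n + 2), |binom n j - binom (n + 1) j| ≤ (√(n + 1 : ℕ))⁻¹ := by
  have hN : (0 : ℝ) < (n + 1 : ℕ) := by positivity
  calc _ = ∑ j ∈ Finset.range (n + 2), √(binom (n + 1) j) *
        (√(binom (n + 1) j) * (|((n + 1 : ℕ) - 2 * j : ℝ)| / (n + 1 : ℕ))) := by
        refine Finset.sum_congr rfl fun j hj => ?_
        rw [binom_sub_binom_succ (by have := Finset.mem_range.1 hj; omega), abs_div, abs_mul,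
          abs_of_nonneg (binom_nonneg _ _), abs_of_pos hN, ← mul_assoc,
          mul_self_sqrt (binom_nonneg _ _)]
        ring
    _ ≤ √(∑ j ∈ Finset.range (n + 2), √(binom (n + 1) j) ^ 2) *
        √(∑ j ∈ Finset.range (n + 2),
          (√(binom (n + 1) j) * (|((n + 1 : ℕ) - 2 * j : ℝ)| / (n + 1 : ℕ))) ^ 2) :=
        sum_mul_le_sqrt_mul_sqrt _ _ _
    _ = _ := by
        simp only [mul_pow, div_pow, sq_abs, sq_sqrt (binom_nonneg _ _)]
        rw [sum_binom (n + 1), sqrt_one, one_mul, ← sqrt_inv]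
        congr 1
        have h := sum_sq_mul_binom (n + 1)
        simp only [← mul_div_assoc]
        rw [← Finset.sum_div, Finset.sum_congr rfl fun j _ => mul_comm _ _, h]
        field_simp

end Binomial

lemma lazyStep_pow (S : Finset G) (n : ℕ) :
    lazyStep S ^ n = ∑ j ∈ Finset.range (n + 1), binom n j • srwStep S ^ j := by
  rw [lazyStep, smul_pow, (Commute.one_right (srwStep S)).add_pow, Finset.smul_sum]
  refine Finset.sum_congr rfl fun j _ => ?_
  rw [one_pow, mul_one, ← nsmul_eq_mul', ← Nat.cast_smul_eq_nsmul ℝ, smul_smul, binom, inv_pow,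
    inv_mul_eq_div]

lemma tendsto_l1_lazyStep_pow_sub (hne : S.Nonempty) (hsymm : ∀ s ∈ S, s⁻¹ ∈ S) :
    Tendsto (fun n : ℕ => l1 (lazyStep S ^ n - lazyStep S ^ (n + 1))) atTop (𝓝 0) := by
  have hp := (isStep_srwStep hne hsymm).isProb
  have hlim : Tendsto (fun n : ℕ => (√(n + 1 : ℕ))⁻¹) atTop (𝓝 0) :=
    (tendsto_sqrt_atTop.comp
      (tendsto_natCast_atTop_atTop.comp (tendsto_add_atTop_nat 1))).inv_tendsto_atTop
  refine squeeze_zero (fun n => l1_nonneg _) (fun n => ?_) hlim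
  rw [← expect_sign_eq_l1]
  set f : G → ℝ := fun x =>
    (SignType.sign ((lazyStep S ^ n - lazyStep S ^ (n + 1)).coeff x) : ℝ) with hf
  have hf1 : ∀ y, |f y| ≤ 1 := fun y => abs_sign_le_one _
  -- The added term vanishes since `n.choose (n + 1) = 0`; both powers become sums over one range.
  have hlast : ∑ j ∈ Finset.range (n + 1), binom n j • srwStep S ^ j
      = ∑ j ∈ Finset.range (n + 2), binom n j • srwStep S ^ j := by
    rw [Finset.sum_range_succ _ (n + 1)]
    simp [binom]
  rw [lazyStep_pow S n, lazyStep_pow S (n + 1), hlast, ← Finset.sum_sub_distrib]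
  simp only [← sub_smul, expect_sum, expect_smul]
  refine (Finset.sum_le_sum fun j _ => ?_).trans (sum_abs_binom_sub_le n)
  refine (le_abs_self _).trans ?_
  rw [abs_mul]
  exact mul_le_of_le_one_right (abs_nonneg _) ((hp.pow j).abs_expect_le hf1)

/-- Concavity of entropy. -/
lemma sum_mul_H_le_H_sum {ι : Type*} (s : Finset ι) {w : ι → ℝ} {b : ι → MonoidAlgebra ℝ G}
    (hw : ∀ i ∈ s, 0 ≤ w i) (hw1 : ∑ i ∈ s, w i = 1) (hb : ∀ i ∈ s, IsProb (b i)) :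
    ∑ i ∈ s, w i * H (b i) ≤ H (∑ i ∈ s, w i • b i) := by
  classical
  set F := (s.biUnion fun i => (b i).coeff.support) ∪ (∑ i ∈ s, w i • b i).coeff.support
  rw [H_eq_sum_negMulLog _ (Finset.subset_union_right : _ ⊆ F)]
  calc _ = ∑ i ∈ s, w i * ∑ x ∈ F, negMulLog ((b i).coeff x) :=
        Finset.sum_congr rfl fun i hi => by
          rw [H_eq_sum_negMulLog (b i) (F := F)]
          exact (Finset.subset_biUnion_of_mem (fun i => (b i).coeff.support) hi).trans
            Finset.subset_union_left
    _ = ∑ x ∈ F, ∑ i ∈ s, w i * negMulLog ((b i).coeff x) := by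
        simp only [Finset.mul_sum]; exact Finset.sum_comm
    _ ≤ _ := Finset.sum_le_sum fun x _ => by
        have := concaveOn_negMulLog.le_map_sum hw hw1
          (p := fun i => (b i).coeff x) fun i hi => (hb i hi).nonneg x
        simpa [MonoidAlgebra.coeff_sum, Finsupp.finsetSum_apply] using this

/-- Concavity of entropy over the binomial time, whose mean is `n / 2`. This carries positive
entropy from simple to lazy random walk. -/
lemma half_mul_le_H_lazyStep_pow (hne : S.Nonempty) (hsymm : ∀ s ∈ S, s⁻¹ ∈ S) {h : ℝ}
    (hh : ∀ n : ℕ, n ≠ 0 → h ≤ H (srwStep S ^ n) / n) (n : ℕ) : h / 2 * n ≤ H (lazyStep S ^ n) := by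
  have hp := (isStep_srwStep hne hsymm).isProb
  have hle : ∀ j : ℕ, h * j ≤ H (srwStep S ^ j) := fun j => by
    rcases eq_or_ne j 0 with rfl | hj
    · simpa using (hp.pow 0).H_nonneg
    · have hj' : (0 : ℝ) < j := by positivity
      exact (le_div_iff₀ hj').1 (hh j hj)
  rw [lazyStep_pow]
  refine le_trans ?_ (sum_mul_H_le_H_sum _ (fun j _ => binom_nonneg n j) (sum_binom n)
    fun j _ => hp.pow j)
  calc h / 2 * n = h * ∑ j ∈ Finset.range (n + 1), (j : ℝ) * binom n j := by rw [sum_mul_binom]; ring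
    _ = ∑ j ∈ Finset.range (n + 1), binom n j * (h * j) := by
        rw [Finset.mul_sum]; exact Finset.sum_congr rfl fun _ _ => by ring
    _ ≤ _ := Finset.sum_le_sum fun j _ => mul_le_mul_of_nonneg_left (hle j) (binom_nonneg n j)

/-- Positivity of the asymptotic entropy is equivalent to the failure of the Liouville property. -/
lemma exists_harmonic_iff_entropy_pos (hne : S.Nonempty) (hsymm : ∀ s ∈ S, s⁻¹ ∈ S)
    (hgen : Subgroup.closure (S : Set G) = ⊤) (ha : a = srwStep S ∨ a = lazyStep S) {h : ℝ}
    (hh : Tendsto (fun n : ℕ => H (a ^ n) / n) atTop (𝓝 h)) :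
    (∃ u : G → ℝ, (∃ C : ℝ, ∀ x, |u x| ≤ C) ∧ IsHarmonic S u ∧ ∃ x y, u x ≠ u y) ↔ 0 < h := by
  have hstep : IsStep S a := by
    rcases ha with rfl | rfl
    exacts [isStep_srwStep hne hsymm, isStep_lazyStep hne hsymm]
  constructor
  · rintro ⟨u, ⟨C, hC⟩, hu, x, y, hxy⟩
    have hu' : ∀ x, expect (fun s => u (x * s)) a = u x := by
      rcases ha with rfl | rfl
      exacts [isHarmonic_iff_srwStep.1 hu, isHarmonic_iff_lazyStep.1 hu]
    refine (ge_of_tendsto' hh fun n => div_nonneg (hstep.isProb.pow n).H_nonneg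
      n.cast_nonneg).lt_of_ne ?_
    rintro rfl
    have hconst := hstep.eq_of_harmonic_of_entropy_eq_zero hgen hh hC hu'
    exact hxy ((hconst x).trans (hconst y).symm)
  · intro h0
    -- The harmonic function is built from the lazy walk whichever walk `a` is, since asymptotic
    -- invariance is at hand only there.
    have hlazy := isStep_lazyStep hne hsymm
    obtain ⟨l, hl, -⟩ := exists_tendsto_div_of_subadditive hlazy.subadditive_H
      fun n => (hlazy.isProb.pow n).H_nonneg
    have hl0 : 0 < l := by
      rcases ha with rfl | rfl
      · obtain ⟨h', hh', hle⟩ := exists_tendsto_div_of_subadditive hstep.subadditive_H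
          fun n => (hstep.isProb.pow n).H_nonneg
        obtain rfl := tendsto_nhds_unique hh hh'
        refine (half_pos h0).trans_le (ge_of_tendsto hl ?_)
        filter_upwards [eventually_ne_atTop 0] with n hn
        have hn' : (0 : ℝ) < n := by positivity
        exact (le_div_iff₀ hn').2 (half_mul_le_H_lazyStep_pow hne hsymm hle n)
      · rwa [tendsto_nhds_unique hl hh]
    obtain ⟨u, hu1, hu, hne'⟩ := hlazy.isProb.exists_harmonic_of_entropy_pos hl0 hl
      (tendsto_l1_lazyStep_pow_sub hne hsymm)
    exact ⟨u, ⟨1, hu1⟩, isHarmonic_iff_lazyStep.2 hu, hne'⟩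

end GroupWalk

end

/-! ### The chain as partial products of i.i.d. steps. -/

noncomputable section

namespace GroupWalk

open ProbabilityTheory
open scoped ENNReal

variable {G : Type*}

section StepMeasure

variable [MeasurableSpace G]

/-- The measure on `G` with finitely supported density `a`. -/
def stepMeasure (a : MonoidAlgebra ℝ G) : Measure G :=
  ∑ x ∈ a.coeff.support, ENNReal.ofReal (a.coeff x) • Measure.dirac x

variable [DiscreteMeasurableSpace G]

lemma lintegral_stepMeasure {a : MonoidAlgebra ℝ G} (ha : ∀ x, 0 ≤ a.coeff x) {f : G → ℝ}
    (hf : ∀ x, 0 ≤ f x) :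
    ∫⁻ x, ENNReal.ofReal (f x) ∂(stepMeasure a) = ENNReal.ofReal (expect f a) := by
  rw [stepMeasure, lintegral_finsetSum_measure, expect_eq_sum,
    ENNReal.ofReal_sum_of_nonneg fun x _ => mul_nonneg (ha x) (hf x)]
  refine Finset.sum_congr rfl fun x _ => ?_
  rw [lintegral_smul_measure, lintegral_dirac, ENNReal.ofReal_mul (ha x), smul_eq_mul]

lemma integral_stepMeasure {a : MonoidAlgebra ℝ G} (ha : ∀ x, 0 ≤ a.coeff x) {f : G → ℝ}
    (hf : ∀ x, 0 ≤ f x) : ∫ x, f x ∂(stepMeasure a) = expect f a := by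
  rw [integral_eq_lintegral_of_nonneg_ae (ae_of_all _ hf)
    (Measurable.of_discrete.aestronglyMeasurable), lintegral_stepMeasure ha hf,
    ENNReal.toReal_ofReal (expect_nonneg ha fun x _ => hf x)]

lemma stepMeasure_singleton {a : MonoidAlgebra ℝ G} (x : G) :
    stepMeasure a {x} = ENNReal.ofReal (a.coeff x) := by
  classical
  rw [stepMeasure, Measure.finsetSum_apply]
  simp only [Measure.smul_apply, smul_eq_mul, Measure.dirac_apply, Set.indicator_apply,
    Set.mem_singleton_iff, Pi.one_apply, mul_ite, mul_one, mul_zero]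
  rw [Finset.sum_ite_eq']
  split_ifs with h
  · rfl
  · rw [Finsupp.notMem_support_iff.1 h, ENNReal.ofReal_zero]

lemma IsProb.isProbabilityMeasure {a : MonoidAlgebra ℝ G} (ha : IsProb a) :
    IsProbabilityMeasure (stepMeasure a) := ⟨by
  have := lintegral_stepMeasure ha.nonneg (f := fun _ => 1) fun _ => zero_le_one
  simpa [ha.total] using this⟩

lemma ae_coeff_ne_zero (a : MonoidAlgebra ℝ G) : ∀ᵐ x ∂(stepMeasure a), a.coeff x ≠ 0 := by
  rw [ae_iff, stepMeasure, Measure.finsetSum_apply]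
  refine Finset.sum_eq_zero fun x hx => ?_
  have : a.coeff x ≠ 0 := by simpa using hx
  simp [this]

/-- The law of an i.i.d. sequence of steps. -/
def stepsLaw (a : MonoidAlgebra ℝ G) : Measure (ℕ → G) :=
  Measure.infinitePi fun _ => stepMeasure a

lemma IsProb.isProbabilityMeasure_stepsLaw {a : MonoidAlgebra ℝ G} (ha : IsProb a) :
    IsProbabilityMeasure (stepsLaw a) := by
  have := ha.isProbabilityMeasure
  unfold stepsLaw; infer_instance

lemma IsProb.measurePreserving_shift {a : MonoidAlgebra ℝ G} (ha : IsProb a) (k : ℕ) :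
    MeasurePreserving (fun (y : ℕ → G) i => y (i + k)) (stepsLaw a) (stepsLaw a) := by
  have := ha.isProbabilityMeasure
  exact ⟨by fun_prop, Measure.map_infinitePi_infinitePi_of_inj (P := fun _ : ℕ => stepMeasure a)
    (add_left_injective k)⟩

lemma IsProb.ae_stepsLaw_coeff_ne_zero {a : MonoidAlgebra ℝ G} (ha : IsProb a) :
    ∀ᵐ y ∂(stepsLaw a), ∀ i, a.coeff (y i) ≠ 0 := by
  have := ha.isProbabilityMeasure
  rw [ae_all_iff]
  exact fun i => (measurePreserving_eval_infinitePi
    (fun _ : ℕ => stepMeasure a) i).quasiMeasurePreserving.ae (ae_coeff_ne_zero a)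

end StepMeasure

variable [Group G]

/-- The partial products `y₀ y₁ ⋯ y_{n-1}`. -/
def pathProd (y : ℕ → G) : ℕ → G
  | 0 => 1
  | n + 1 => pathProd y n * y n

lemma pathProd_add (y : ℕ → G) (m n : ℕ) :
    pathProd y (m + n) = pathProd y m * pathProd (fun i => y (i + m)) n := by
  induction n with
  | zero => simp [pathProd]
  | succ n ih => rw [← add_assoc, pathProd, pathProd, ih, mul_assoc, add_comm n m]

lemma pathProd_congr {y z : ℕ → G} {n : ℕ} (h : ∀ i < n, y i = z i) :
    pathProd y n = pathProd z n := by
  induction n with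
  | zero => rfl
  | succ n ih =>
    rw [pathProd, pathProd, ih fun i hi => h i (hi.trans n.lt_succ_self), h n n.lt_succ_self]

lemma pathProd_increments {Ω : Type*} {X : ℕ → Ω → G} {ω : Ω} (h : X 0 ω = 1) (n : ℕ) :
    pathProd (fun i => (X i ω)⁻¹ * X (i + 1) ω) n = X n ω := by
  induction n with
  | zero => exact h.symm
  | succ n ih => rw [pathProd, ih, mul_inv_cancel_left]

lemma IsMarkovChain.ae_start {Ω : Type*} [MeasurableSpace Ω] {μ : Measure Ω}
    [IsProbabilityMeasure μ] {p : G → G → ℝ} {X : ℕ → Ω → G} (hX : IsMarkovChain p 1 μ X) :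
    ∀ᵐ ω ∂μ, X 0 ω = 1 := by
  have h := hX.path_law_start 0 (fun _ => 1) rfl
  simp only [Nat.le_zero, forall_eq, Finset.range_zero, Finset.prod_empty] at h
  have hm : MeasurableSet {ω | X 0 ω = 1} := hX.measurable 0 (t := {1}) trivial
  rw [measureReal_def, ENNReal.toReal_eq_one_iff] at h
  exact (prob_compl_eq_zero_iff hm).2 h

section Measurable

variable [MeasurableSpace G] [DiscreteMeasurableSpace G] [Countable G]

lemma IsProb.stepMeasure_mconv {a b : MonoidAlgebra ℝ G} (ha : IsProb a) (hb : IsProb b) :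
    Measure.mconv (stepMeasure a) (stepMeasure b) = stepMeasure (a * b) := by
  classical
  have := ha.isProbabilityMeasure
  have := hb.isProbabilityMeasure
  have h1 : ∀ x y : G, (0 : ℝ) ≤ if y = x then 1 else 0 := fun x y => by
    split_ifs <;> norm_num
  refine Measure.ext_of_singleton fun x => ?_
  have hind : ∀ ρ : Measure G, ρ {x} = ∫⁻ y, ENNReal.ofReal (if y = x then 1 else 0) ∂ρ :=
    fun ρ => by
      rw [← lintegral_indicator_one (MeasurableSet.singleton x)]
      congr 1; ext y
      by_cases h : y = x <;> simp [h]
  rw [hind, hind, lintegral_stepMeasure (ha.mul hb).nonneg (h1 x),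
    Measure.lintegral_mconv (Measurable.of_discrete), expect_mul]
  rw [← lintegral_stepMeasure ha.nonneg fun y => expect_nonneg hb.nonneg fun z _ => h1 x _]
  congr 1; ext y
  exact lintegral_stepMeasure hb.nonneg fun z => h1 x (y * z)

lemma measurable_pathProd (n : ℕ) : Measurable fun y : ℕ → G => pathProd y n := by
  induction n with
  | zero => exact measurable_const
  | succ n ih => exact ih.mul (measurable_pi_apply n)

lemma IsProb.indepFun_of_dependsOn {a : MonoidAlgebra ℝ G} (ha : IsProb a) {s t : Finset ℕ}
    (hst : Disjoint s t) {f g : (ℕ → G) → G} (hf : DependsOn f (s : Set ℕ))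
    (hg : DependsOn g (t : Set ℕ)) : IndepFun f g (stepsLaw a) := by
  classical
  have := ha.isProbabilityMeasure
  have hind : iIndepFun (fun (i : ℕ) (y : ℕ → G) => y i) (stepsLaw a) :=
    iIndepFun_infinitePi (P := fun _ : ℕ => stepMeasure a) (X := fun _ x => x) fun _ => measurable_id
  -- Each function factors through finitely many coordinates, the missing ones being filled with
  -- `1`; on that countable product every function is measurable.
  have hfac : ∀ (u : Finset ℕ) (f : (ℕ → G) → G), DependsOn f (u : Set ℕ) →
      f = (fun z : u → G => f fun i => if hi : i ∈ u then z ⟨i, hi⟩ else 1) ∘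
        fun y (i : u) => y i := fun u f hf => by
    ext y
    exact hf fun i hi => by
      have : i ∈ u := hi
      simp [this]
  rw [hfac s f hf, hfac t g hg]
  exact (hind.indepFun_finset s t hst fun i => measurable_pi_apply i).comp
    (measurable_of_countable _) (measurable_of_countable _)

lemma IsProb.map_pathProd_stepsLaw {a : MonoidAlgebra ℝ G} (ha : IsProb a) (n : ℕ) :
    (stepsLaw a).map (fun y => pathProd y n) = stepMeasure (a ^ n) := by
  have := ha.isProbabilityMeasure
  have := ha.isProbabilityMeasure_stepsLaw
  induction n with
  | zero =>
    simp only [pathProd, pow_zero, Measure.map_const, measure_univ, one_smul]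
    refine Measure.ext_of_singleton fun x => ?_
    classical
    rw [stepMeasure_singleton, MonoidAlgebra.one_def, MonoidAlgebra.coeff_single,
      Finsupp.single_apply, Measure.dirac_apply]
    by_cases h : 1 = x <;> simp [h]
  | succ n ih =>
    have hind : IndepFun (fun y : ℕ → G => pathProd y n) (fun y => y n) (stepsLaw a) := by
      refine ha.indepFun_of_dependsOn (s := Finset.range n) (t := {n}) (by simp) ?_ ?_
      · exact fun y z h => pathProd_congr fun i hi => h i (by simpa using hi)
      · exact fun y z h => h n (by simp)
    have := (ha.pow n).isProbabilityMeasure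
    have heval : (stepsLaw a).map (fun y => y n) = stepMeasure a :=
      Measure.infinitePi_map_eval (fun _ : ℕ => stepMeasure a) n
    have hmul := hind.map_mul_eq_map_mconv_map' (measurable_pathProd n) (measurable_pi_apply n)
      (by rw [ih]; infer_instance) (by rw [heval]; infer_instance)
    rw [pow_succ, ← (ha.pow n).stepMeasure_mconv ha, ← ih, ← heval, ← hmul]
    rfl

variable {Ω : Type*} [MeasurableSpace Ω] {μ : Measure Ω} [IsProbabilityMeasure μ]
  {p : G → G → ℝ} {X : ℕ → Ω → G}

/-- The increments of a random walk are i.i.d. -/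
lemma IsMarkovChain.map_increments (hX : IsMarkovChain p 1 μ X) {a : MonoidAlgebra ℝ G}
    (ha : IsProb a) (hp : ∀ x y, p x y = a.coeff (x⁻¹ * y)) :
    Measurable (fun ω i => (X i ω)⁻¹ * X (i + 1) ω) ∧
    μ.map (fun ω i => (X i ω)⁻¹ * X (i + 1) ω) = stepsLaw a := by
  classical
  have := ha.isProbabilityMeasure
  have hmX : ∀ n, Measurable (X n) := fun n s _ => hX.measurable n (t := s) trivial
  have hmeas : Measurable (fun ω i => (X i ω)⁻¹ * X (i + 1) ω) :=
    measurable_pi_lambda _ fun i => (hmX i).inv.mul (hmX (i + 1))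
  refine ⟨hmeas, ?_⟩
  -- The first `n` increments live in a countable space, so their law is checked on points; as `X 0
  -- = 1` almost surely, a point is one path, whose probability the chain prescribes.
  have hfin : ∀ n : ℕ, (μ.map (fun ω i => (X i ω)⁻¹ * X (i + 1) ω)).map (Finset.range n).restrict
      = Measure.pi fun _ : Finset.range n => stepMeasure a := fun n => by
    refine Measure.ext_of_singleton fun z => ?_
    rw [Measure.pi_singleton, Measure.map_map (by fun_prop) hmeas,
      Measure.map_apply (by fun_prop) (MeasurableSet.singleton z)]
    set y : ℕ → G := fun i => if hi : i ∈ Finset.range n then z ⟨i, hi⟩ else 1 with hy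
    have hset : μ ((Finset.restrict (Finset.range n) ∘ fun ω i => (X i ω)⁻¹ * X (i + 1) ω) ⁻¹' {z})
        = μ {ω | ∀ i ≤ n, X i ω = pathProd y i} := by
      refine measure_congr ?_
      filter_upwards [hX.ae_start] with ω hω
      refine propext ?_
      change (Finset.range n).restrict (fun i => (X i ω)⁻¹ * X (i + 1) ω) = z ↔
        ∀ i ≤ n, X i ω = pathProd y i
      constructor
      · intro h i hi
        rw [← pathProd_increments hω i]
        refine pathProd_congr fun j hj => ?_
        have hjn : j ∈ Finset.range n := Finset.mem_range.2 (hj.trans_le hi)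
        simp only [hy, dif_pos hjn, ← h]
        rfl
      · intro h
        ext ⟨i, hi⟩
        have hin := Finset.mem_range.1 hi
        simp only [Finset.restrict]
        rw [h i hin.le, h (i + 1) hin, pathProd, inv_mul_cancel_left]
        simp only [hy, dif_pos hi]
    have hlaw := hX.path_law_start n (pathProd y) rfl
    rw [measureReal_def] at hlaw
    rw [hset, ← ENNReal.ofReal_toReal (measure_ne_top μ _), hlaw,
      ENNReal.ofReal_prod_of_nonneg fun i _ => by rw [hp]; exact ha.nonneg _]
    simp only [stepMeasure_singleton]
    rw [Finset.univ_eq_attach, ← Finset.prod_attach]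
    refine Finset.prod_congr rfl fun i _ => ?_
    rw [hp, pathProd, inv_mul_cancel_left]
    simp only [hy, dif_pos i.2]
  refine Measure.eq_infinitePi _ fun s t ht => ?_
  -- A cylinder over `s` is also one over `range n`, with mass-one factors `univ` at the indices
  -- outside `s`.
  set n := s.sup id + 1
  have hsn : s ⊆ Finset.range n := fun i hi =>
    Finset.mem_range.2 (Nat.lt_succ_of_le (Finset.le_sup (f := id) hi))
  have hpre : Set.pi (s : Set ℕ) t = (Finset.range n).restrict ⁻¹'
      (Set.univ.pi fun i : Finset.range n => if (i : ℕ) ∈ s then t i else Set.univ) := by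
    ext y
    simp only [Set.mem_pi, Set.mem_preimage, Finset.restrict, Set.mem_univ, true_imp_iff]
    constructor
    · intro h i
      split_ifs with hi
      · exact h i hi
      · trivial
    · intro h i hi
      have := h ⟨i, hsn hi⟩
      simpa only [if_pos (show i ∈ s from hi)] using this
  have hmt : ∀ i : Finset.range n, MeasurableSet (if (i : ℕ) ∈ s then t i else Set.univ) :=
    fun _ => MeasurableSet.of_discrete
  rw [hpre, ← Measure.map_apply (by fun_prop) (MeasurableSet.univ_pi hmt), hfin, Measure.pi_pi,
    Finset.univ_eq_attach,
    Finset.prod_attach (Finset.range n)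
      (fun i => stepMeasure a (if i ∈ s then t i else Set.univ)),
    ← Finset.prod_subset hsn]
  · exact Finset.prod_congr rfl fun i hi => by rw [if_pos hi]
  · intro i _ hi
    rw [if_neg hi, measure_univ]

lemma IsMarkovChain.map_eq_stepMeasure (hX : IsMarkovChain p 1 μ X) {a : MonoidAlgebra ℝ G}
    (ha : IsProb a) (hp : ∀ x y, p x y = a.coeff (x⁻¹ * y)) (n : ℕ) :
    μ.map (X n) = stepMeasure (a ^ n) := by
  obtain ⟨hm, hmap⟩ := hX.map_increments ha hp
  rw [← ha.map_pathProd_stepsLaw n, ← hmap, Measure.map_map (measurable_pathProd n) hm]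
  refine Measure.map_congr ?_
  filter_upwards [hX.ae_start] with ω hω
  exact (pathProd_increments hω n).symm

lemma IsMarkovChain.entropy_eq (hX : IsMarkovChain p 1 μ X) {a : MonoidAlgebra ℝ G}
    (ha : IsProb a) (hp : ∀ x y, p x y = a.coeff (x⁻¹ * y)) (n : ℕ) :
    entropy μ (X n) = H (a ^ n) := by
  have hmX : Measurable (X n) := fun s _ => hX.measurable n (t := s) trivial
  have hlaw : ∀ x, μ.real {ω | X n ω = x} = (a ^ n).coeff x := fun x => by
    have h := congrArg (fun ρ : Measure G => ρ.real {x}) (hX.map_eq_stepMeasure ha hp n)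
    simp only [measureReal_def] at h ⊢
    rw [Measure.map_apply hmX (MeasurableSet.singleton x), stepMeasure_singleton,
      ENNReal.toReal_ofReal ((ha.pow n).nonneg x)] at h
    exact h
  simp only [entropy, hlaw]
  rw [tsum_eq_sum (s := (a ^ n).coeff.support), H, expect_eq_sum]
  · simp [Real.log_inv]
  · intro x hx
    rw [Finsupp.notMem_support_iff.1 hx, zero_mul]

lemma IsMarkovChain.integral_wordLength (hX : IsMarkovChain p 1 μ X) {a : MonoidAlgebra ℝ G}
    (ha : IsProb a) (hp : ∀ x y, p x y = a.coeff (x⁻¹ * y)) (S : Finset G) (n : ℕ) :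
    ∫ ω, (wordLength S (X n ω) : ℝ) ∂μ = meanLength S (a ^ n) := by
  have hmX : Measurable (X n) := fun s _ => hX.measurable n (t := s) trivial
  rw [meanLength, ← integral_stepMeasure (ha.pow n).nonneg fun x => Nat.cast_nonneg _,
    ← hX.map_eq_stepMeasure ha hp n, integral_map hmX.aemeasurable
      Measurable.of_discrete.aestronglyMeasurable]

end Measurable

end GroupWalk

end

/-! ### Almost sure existence of the speed. -/

noncomputable section

namespace GroupWalk

open ProbabilityTheory

/-- A subadditive array with unit increments which, from every good position, admits a
block of length at most `N` and slope at most `c`, grows with slope at most `c` up to the number of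
bad positions. -/
lemma le_of_greedy_blocks {F : ℕ → ℕ → ℝ} (hadd : ∀ k m n, F k (m + n) ≤ F k m + F (k + m) n)
    (hle : ∀ k n, F k n ≤ n) {c : ℝ} (hc : 0 ≤ c) {N : ℕ} {b : ℕ → ℝ} (hb : ∀ k, 0 ≤ b k)
    (hgood : ∀ k, b k < 1 → ∃ n, 1 ≤ n ∧ n ≤ N ∧ F k n ≤ c * n) (M : ℕ) :
    ∀ k, F k M ≤ c * M + ∑ i ∈ Finset.range M, b (k + i) + N := by
  induction M using Nat.strong_induction_on with
  | _ M ih =>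
    intro k
    have hsum : ∀ k M, 0 ≤ ∑ i ∈ Finset.range M, b (k + i) :=
      fun k M => Finset.sum_nonneg fun i _ => hb _
    rcases le_or_gt M N with hMN | hMN
    · have h1 : (M : ℝ) ≤ N := by exact_mod_cast hMN
      have h2 : 0 ≤ c * M := by positivity
      linarith [hle k M, hsum k M]
    have step : ∀ n, 1 ≤ n → n ≤ M → F k M ≤ F k n + (c * (M - n) +
        (∑ i ∈ Finset.range M, b (k + i) - ∑ i ∈ Finset.range n, b (k + i)) + N) := by
      intro n hn1 hnM
      obtain ⟨m, rfl⟩ := Nat.exists_eq_add_of_le hnM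
      have h1 := hadd k n m
      have h2 := ih m (by omega) (k + n)
      rw [Finset.sum_range_add]
      simp only [← add_assoc]
      push_cast
      have h3 : c * (n + m - n : ℝ) = c * m := by ring
      linarith
    -- From a good position cut off the slow block; from a bad one cut off a single step, whose cost
    -- of at most `1` is paid by `b k`. A remainder shorter than `N` went into the additive `N`.
    by_cases hk : b k < 1
    · obtain ⟨n, hn1, hnN, hn⟩ := hgood k hk
      have h1 := step n hn1 (by omega)
      linarith [hsum k n]
    · have h1 := step 1 le_rfl (by omega)
      have h2 := hle k 1
      simp only [Finset.range_one, Finset.sum_singleton, add_zero, Nat.cast_one] at h1 h2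
      linarith

variable {G : Type*} [Group G]

/-- The length of the product of the first `n` steps. -/
def pathLength (S : Finset G) (n : ℕ) (y : ℕ → G) : ℝ := wordLength S (pathProd y n)

variable {S : Finset G} {a : MonoidAlgebra ℝ G}

lemma pathLength_nonneg (n : ℕ) (y : ℕ → G) : 0 ≤ pathLength S n y := Nat.cast_nonneg _

lemma pathLength_add_le (hsymm : ∀ s ∈ S, s⁻¹ ∈ S) (hgen : Subgroup.closure (S : Set G) = ⊤)
    (m n : ℕ) (y : ℕ → G) :
    pathLength S (m + n) y ≤ pathLength S m y + pathLength S n (fun i => y (i + m)) := by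
  simp only [pathLength, pathProd_add]
  exact_mod_cast wordLength_mul_le hsymm hgen _ _

lemma IsStep.wordLength_le_one (hgen : Subgroup.closure (S : Set G) = ⊤) (ha : IsStep S a) {x : G}
    (hx : a.coeff x ≠ 0) : wordLength S x ≤ 1 := by
  simpa using ha.wordLength_mul_le_succ hgen 1 x hx

lemma IsStep.pathLength_le (hgen : Subgroup.closure (S : Set G) = ⊤)
    (ha : IsStep S a) {y : ℕ → G} (hy : ∀ i, a.coeff (y i) ≠ 0) (n : ℕ) :
    pathLength S n y ≤ n := by
  induction n with
  | zero => simp [pathLength, pathProd]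
  | succ n ih =>
    have h : pathLength S (n + 1) y ≤ pathLength S n y + 1 := by
      simp only [pathLength, pathProd]
      exact_mod_cast ha.wordLength_mul_le_succ hgen _ _ (hy n)
    push_cast
    linarith

lemma IsStep.pathLength_shift_le (hsymm : ∀ s ∈ S, s⁻¹ ∈ S)
    (hgen : Subgroup.closure (S : Set G) = ⊤) (ha : IsStep S a) {y : ℕ → G}
    (hy : ∀ i, a.coeff (y i) ≠ 0) (n : ℕ) :
    pathLength S n (fun i => y (i + 1)) ≤ pathLength S (n + 1) y + 1 := by
  have h1 : pathProd (fun i => y (i + 1)) n = (y 0)⁻¹ * pathProd y (n + 1) := by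
    rw [add_comm n 1, pathProd_add]; simp [pathProd]
  have h2 : wordLength S (y 0)⁻¹ ≤ 1 := ha.wordLength_le_one hgen (by
    rw [← coeff_rev, ha.rev_eq]; exact hy 0)
  have h3 := wordLength_mul_le hsymm hgen (y 0)⁻¹ (pathProd y (n + 1))
  rw [← h1] at h3
  simp only [pathLength]
  exact_mod_cast h3.trans (by omega)

/-- The sequences of steps whose lower speed is less than `c`. -/
def slowSet (S : Finset G) (c : ℝ) : Set (ℕ → G) :=
  {y | ∃ q : ℚ, (q : ℝ) < c ∧ ∃ᶠ n : ℕ in atTop, pathLength S n y ≤ q * n}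

/-- Dropping the first step changes the length by at most one, absorbed by the gap between `q` and a
larger rational below `c`. This invariance keeps every position of a slow path slow. -/
lemma IsStep.shift_mem_slowSet (hsymm : ∀ s ∈ S, s⁻¹ ∈ S)
    (hgen : Subgroup.closure (S : Set G) = ⊤) (ha : IsStep S a) {c : ℝ} {y : ℕ → G}
    (hy : ∀ i, a.coeff (y i) ≠ 0) (hyc : y ∈ slowSet S c) :
    (fun i => y (i + 1)) ∈ slowSet S c := by
  obtain ⟨q, hq, hfreq⟩ := hyc
  obtain ⟨r, hqr, hrc⟩ := exists_rat_btwn hq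
  refine ⟨r, hrc, ?_⟩
  have hlarge : ∀ᶠ n : ℕ in atTop, q + 1 ≤ ((r : ℝ) - q) * n :=
    ((tendsto_natCast_atTop_atTop (R := ℝ)).const_mul_atTop (sub_pos.2 hqr)).eventually_ge_atTop _
  have hfreq' : ∃ᶠ n : ℕ in atTop, pathLength S (n + 1) y ≤ q * (n + 1 : ℕ) := by
    rw [← map_add_atTop_eq_nat 1, frequently_map] at hfreq
    exact hfreq
  refine (hfreq'.and_eventually hlarge).mono fun n hn => ?_
  have := ha.pathLength_shift_le hsymm hgen hy n
  have h1 := hn.1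
  push_cast at h1
  linarith [hn.2]

lemma IsStep.shift_iterate_mem_slowSet (hsymm : ∀ s ∈ S, s⁻¹ ∈ S)
    (hgen : Subgroup.closure (S : Set G) = ⊤) (ha : IsStep S a) {c : ℝ} {y : ℕ → G}
    (hy : ∀ i, a.coeff (y i) ≠ 0) (hyc : y ∈ slowSet S c) (k : ℕ) :
    (fun i => y (i + k)) ∈ slowSet S c := by
  induction k with
  | zero => exact hyc
  | succ k ih =>
    have := ha.shift_mem_slowSet hsymm hgen (fun i => hy (i + k)) ih
    simpa only [add_assoc, add_comm k 1] using this

/-- The slow sequences all of whose initial blocks of length at most `N` have slope above `c`. -/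
def badSet (S : Finset G) (c : ℝ) (N : ℕ) : Set (ℕ → G) :=
  slowSet S c ∩ {y | ∀ n, 1 ≤ n → n ≤ N → c * n < pathLength S n y}

lemma iInter_badSet (c : ℝ) : ⋂ N, badSet S c N = ∅ := by
  refine Set.eq_empty_of_forall_notMem fun y hy => ?_
  rw [Set.mem_iInter] at hy
  obtain ⟨q, hq, hfreq⟩ := (hy 0).1
  obtain ⟨n, hn, hn1⟩ := (hfreq.and_eventually (eventually_ge_atTop 1)).exists
  have h1 := (hy n).2 n hn1 le_rfl
  have h2 : (q : ℝ) * n ≤ c * n := by gcongr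
  linarith

lemma pathLength_mul_le (hsymm : ∀ s ∈ S, s⁻¹ ∈ S) (hgen : Subgroup.closure (S : Set G) = ⊤)
    (k m : ℕ) (y : ℕ → G) : pathLength S (m * k) y
      ≤ ∑ j ∈ Finset.range m, pathLength S k (fun i => y (i + j * k)) := by
  induction m with
  | zero => simp [pathLength, pathProd]
  | succ m ih =>
    rw [Nat.succ_mul, Finset.sum_range_succ]
    exact (pathLength_add_le hsymm hgen _ _ y).trans (by gcongr)

section Measurable

variable [MeasurableSpace G] [DiscreteMeasurableSpace G] [Countable G]

lemma measurable_pathLength (S : Finset G) (n : ℕ) : Measurable (pathLength S n) :=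
  (Measurable.of_discrete (f := fun x : G => (wordLength S x : ℝ))).comp (measurable_pathProd n)

lemma measurableSet_slowSet (S : Finset G) (c : ℝ) : MeasurableSet (slowSet S c) := by
  have h : slowSet S c = ⋃ q : ℚ, ⋃ _ : (q : ℝ) < c, ⋂ m : ℕ, ⋃ n : ℕ, ⋃ _ : m ≤ n,
      {y | pathLength S n y ≤ q * n} := by
    ext y
    simp [slowSet, frequently_atTop]
  rw [h]
  exact .iUnion fun q => .iUnion fun _ => .iInter fun m => .iUnion fun n => .iUnion fun _ =>
    measurableSet_le (measurable_pathLength S n) measurable_const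

lemma measurableSet_badSet (S : Finset G) (c : ℝ) (N : ℕ) : MeasurableSet (badSet S c N) := by
  refine (measurableSet_slowSet S c).inter ?_
  have h : {y | ∀ n, 1 ≤ n → n ≤ N → c * n < pathLength S n y}
      = ⋂ n : ℕ, ⋂ _ : 1 ≤ n, ⋂ _ : n ≤ N, {y | c * n < pathLength S n y} := by
    ext y; simp
  rw [h]
  exact .iInter fun n => .iInter fun _ => .iInter fun _ =>
    measurableSet_lt measurable_const (measurable_pathLength S n)

lemma IsProb.integral_pathLength (ha : IsProb a) (n : ℕ) :
    ∫ y, pathLength S n y ∂(stepsLaw a) = meanLength S (a ^ n) := by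
  rw [meanLength, ← integral_stepMeasure (ha.pow n).nonneg fun x => Nat.cast_nonneg _,
    ← ha.map_pathProd_stepsLaw n, integral_map (measurable_pathProd n).aemeasurable
      Measurable.of_discrete.aestronglyMeasurable]
  rfl

lemma IsStep.integrable_pathLength (hgen : Subgroup.closure (S : Set G) = ⊤) (ha : IsStep S a)
    (n : ℕ) : Integrable (pathLength S n) (stepsLaw a) := by
  have := ha.isProb.isProbabilityMeasure_stepsLaw
  refine Integrable.of_bound (measurable_pathLength S n).aestronglyMeasurable (n : ℝ) ?_
  filter_upwards [ha.isProb.ae_stepsLaw_coeff_ne_zero] with y hy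
  rw [Real.norm_of_nonneg (pathLength_nonneg n y)]
  exact ha.pathLength_le hgen hy n

/-- Consecutive blocks of length `k` use disjoint coordinates, so their lengths are independent and
identically distributed, and the strong law applies. -/
lemma IsStep.ae_tendsto_sum_blocks (hgen : Subgroup.closure (S : Set G) = ⊤) (ha : IsStep S a)
    (k : ℕ) : ∀ᵐ y ∂(stepsLaw a), Tendsto (fun m : ℕ =>
      (∑ j ∈ Finset.range m, pathLength S k (fun i => y (i + j * k))) / m) atTop
      (𝓝 (meanLength S (a ^ k))) := by
  have := ha.isProb.isProbabilityMeasure_stepsLaw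
  rw [← ha.isProb.integral_pathLength k]
  have hshift : ∀ j, Measurable fun (y : ℕ → G) i => y (i + j * k) := fun j => by fun_prop
  have h := strong_law_ae_real (μ := stepsLaw a)
    (fun j y => pathLength S k (fun i => y (i + j * k))) ?_ ?_ fun j => ⟨?_, ?_, ?_⟩
  · simpa using h
  · simpa using ha.integrable_pathLength hgen k
  · intro j l hjl
    have hd : Disjoint (Finset.Ico (j * k) (j * k + k)) (Finset.Ico (l * k) (l * k + k)) := by
      rw [Finset.disjoint_left]
      intro i hi hi'
      rw [Finset.mem_Ico] at hi hi'
      rcases lt_or_gt_of_ne hjl with h | h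
      · have := Nat.mul_le_mul_right k (Nat.succ_le_of_lt h)
        rw [Nat.succ_mul] at this; omega
      · have := Nat.mul_le_mul_right k (Nat.succ_le_of_lt h)
        rw [Nat.succ_mul] at this; omega
    have hdep : ∀ j : ℕ, DependsOn (fun y : ℕ → G => pathProd (fun i => y (i + j * k)) k)
        (Finset.Ico (j * k) (j * k + k) : Finset ℕ) := fun j y z h =>
      pathProd_congr fun i hi => h (i + j * k) (by simp; omega)
    exact (ha.isProb.indepFun_of_dependsOn hd (hdep j) (hdep l)).comp
      (φ := fun x => (wordLength S x : ℝ)) (ψ := fun x => (wordLength S x : ℝ))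
      Measurable.of_discrete Measurable.of_discrete
  · exact ((measurable_pathLength S k).comp (hshift j)).aemeasurable
  · exact ((measurable_pathLength S k).comp (hshift 0)).aemeasurable
  · have hmap : ∀ j, Measure.map (fun y : ℕ → G => pathLength S k (fun i => y (i + j * k)))
        (stepsLaw a) = Measure.map (pathLength S k) (stepsLaw a) := fun j => by
      rw [← (ha.isProb.measurePreserving_shift (j * k)).map_eq,
        Measure.map_map (measurable_pathLength S k) (hshift j),
        (ha.isProb.measurePreserving_shift (j * k)).map_eq]
      rfl
    rw [hmap, hmap]

lemma IsStep.ae_eventually_le (hsymm : ∀ s ∈ S, s⁻¹ ∈ S)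
    (hgen : Subgroup.closure (S : Set G) = ⊤) (ha : IsStep S a) {v c : ℝ}
    (hv : Tendsto (fun n : ℕ => meanLength S (a ^ n) / n) atTop (𝓝 v)) (hc : v < c) :
    ∀ᵐ y ∂(stepsLaw a), ∀ᶠ n : ℕ in atTop, pathLength S n y / n < c := by
  obtain ⟨k, hk, hk0⟩ := ((hv.eventually_lt_const hc).and (eventually_ne_atTop 0)).exists
  have hk' : (0 : ℝ) < k := by positivity
  -- Full blocks of length `k` grow with slope below `c'`; the slack `(c - c') n` pays for the
  -- incomplete last block.
  obtain ⟨c', hkc', hc'c⟩ := exists_between hk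
  rw [div_lt_iff₀ hk'] at hkc'
  have hc'0 : 0 ≤ c' := by
    have := (ha.isProb.pow k).meanLength_nonneg (S := S)
    by_contra! hneg
    nlinarith
  filter_upwards [ha.ae_tendsto_sum_blocks hgen k, ha.isProb.ae_stepsLaw_coeff_ne_zero]
    with y hy hsupp
  have hdiv : Tendsto (fun n : ℕ => n / k) atTop atTop := Nat.tendsto_div_const_atTop hk0
  have hev := hdiv.eventually ((hy.eventually_lt_const hkc').and (eventually_ne_atTop 0))
  have hlarge : ∀ᶠ n : ℕ in atTop, (k : ℝ) < (c - c') * n :=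
    ((tendsto_natCast_atTop_atTop (R := ℝ)).const_mul_atTop
      (sub_pos.2 hc'c)).eventually_gt_atTop _
  filter_upwards [hev, hlarge, eventually_ne_atTop 0] with n hn hnl hn0
  have hn' : (0 : ℝ) < n := by positivity
  have hm : (0 : ℝ) < (n / k : ℕ) := by exact_mod_cast Nat.pos_of_ne_zero hn.2
  rw [div_lt_iff₀ hn']
  have h1 := (div_lt_iff₀ hm).1 hn.1
  have h2 := pathLength_mul_le hsymm hgen k (n / k) y
  have h3 := pathLength_add_le hsymm hgen (n / k * k) (n % k) y
  rw [Nat.div_add_mod'] at h3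
  have h4 := ha.pathLength_le hgen (fun i => hsupp (i + n / k * k)) (n % k)
  have h5 : ((n % k : ℕ) : ℝ) ≤ k := by exact_mod_cast (Nat.mod_lt n (Nat.pos_of_ne_zero hk0)).le
  have h6 : ((n / k : ℕ) : ℝ) * k ≤ n := by exact_mod_cast Nat.div_mul_le_self n k
  have h7 : c' * k * (n / k : ℕ) ≤ c' * n := by
    calc _ = c' * ((n / k : ℕ) * k) := by ring
      _ ≤ _ := by gcongr
  linarith

lemma IsStep.tendsto_integral_posPart (hsymm : ∀ s ∈ S, s⁻¹ ∈ S)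
    (hgen : Subgroup.closure (S : Set G) = ⊤) (ha : IsStep S a) {v : ℝ} (hv0 : 0 ≤ v)
    (hv : Tendsto (fun n : ℕ => meanLength S (a ^ n) / n) atTop (𝓝 v)) :
    Tendsto (fun n : ℕ => ∫ y, max (pathLength S n y / n - v) 0 ∂(stepsLaw a)) atTop (𝓝 0) := by
  have := ha.isProb.isProbabilityMeasure_stepsLaw
  have h := tendsto_integral_of_dominated_convergence (μ := stepsLaw a)
    (F := fun (n : ℕ) y => max (pathLength S n y / n - v) 0) (f := fun _ => 0) (fun _ => 1)
    (fun n => ((((measurable_pathLength S n).div_const _).sub_const v).max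
      measurable_const).aestronglyMeasurable) (integrable_const 1) (fun n => ?_) ?_
  · simpa using h
  · filter_upwards [ha.isProb.ae_stepsLaw_coeff_ne_zero] with y hy
    rw [Real.norm_of_nonneg (le_max_right _ _)]
    refine max_le ?_ zero_le_one
    have : pathLength S n y / n ≤ 1 := div_le_one_of_le₀ (ha.pathLength_le hgen hy n) n.cast_nonneg
    linarith
  · have hall : ∀ᵐ y ∂(stepsLaw a), ∀ k : ℕ, ∀ᶠ n : ℕ in atTop,
        pathLength S n y / n < v + 1 / (k + 1) := by
      rw [ae_all_iff]
      exact fun k => ha.ae_eventually_le hsymm hgen hv (by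
        have : (0 : ℝ) < 1 / (k + 1) := by positivity
        linarith)
    filter_upwards [hall] with y hy
    rw [tendsto_order]
    constructor
    · intro b hb
      exact Eventually.of_forall fun n => hb.trans_le (le_max_right _ _)
    · intro b hb
      obtain ⟨k, hk⟩ := exists_nat_one_div_lt hb
      filter_upwards [hy k] with n hn
      exact max_lt (by linarith) hb

/-- Greedy blocks give slope about `c` on the slow set, while elsewhere the slope exceeds `v` by
little in mean. Letting `M → ∞` and then `N → ∞` leaves `v ≤ v - (v - c) P(A)`, with no appeal to
ergodicity. -/
lemma IsStep.measure_slowSet_eq_zero (hsymm : ∀ s ∈ S, s⁻¹ ∈ S)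
    (hgen : Subgroup.closure (S : Set G) = ⊤) (ha : IsStep S a) {v c : ℝ} (hc0 : 0 ≤ c)
    (hcv : c < v) (hv : Tendsto (fun n : ℕ => meanLength S (a ^ n) / n) atTop (𝓝 v)) :
    stepsLaw a (slowSet S c) = 0 := by
  classical
  have := ha.isProb.isProbabilityMeasure_stepsLaw
  set P := stepsLaw a with hP
  set A := slowSet S c with hA
  have hmA : MeasurableSet A := measurableSet_slowSet S c
  set R : ℕ → ℝ := fun M => ∫ y, max (pathLength S M y / M - v) 0 ∂P with hR
  have hR0 : Tendsto R atTop (𝓝 0) := ha.tendsto_integral_posPart hsymm hgen (hc0.trans hcv.le) hv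
  have hintI : ∀ {B : Set (ℕ → G)}, MeasurableSet B →
      Integrable (B.indicator (fun _ => (1 : ℝ))) P := fun hB =>
    (integrable_const 1).indicator hB
  have hint1 : ∀ {B : Set (ℕ → G)}, MeasurableSet B →
      ∫ y, B.indicator (fun _ => (1 : ℝ)) y ∂P = P.real B := fun hB => by
    rw [integral_indicator hB]; simp
  have hbound : ∀ N M : ℕ, M ≠ 0 → meanLength S (a ^ M) / M
      ≤ v - (v - c) * P.real A + P.real (badSet S c N) + N / M + R M := by
    intro N M hM
    have hM' : (0 : ℝ) < M := by positivity
    set B := badSet S c N with hB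
    have hmB : MeasurableSet B := measurableSet_badSet S c N
    set D : (ℕ → G) → ℝ := fun y => ∑ i ∈ Finset.range M,
      B.indicator (fun _ => (1 : ℝ)) (fun j => y (j + i)) with hD
    have hDi : ∀ i, Integrable (fun y : ℕ → G =>
        B.indicator (fun _ => (1 : ℝ)) (fun j => y (j + i))) P := fun i =>
      (ha.isProb.measurePreserving_shift i).integrable_comp_of_integrable (hintI hmB)
    have hDint : Integrable D P := integrable_finsetSum _ fun i _ => hDi i
    have hDval : ∫ y, D y ∂P = M * P.real B := by
      rw [hD, integral_finsetSum _ fun i _ => hDi i]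
      have : ∀ i, ∫ y, B.indicator (fun _ => (1 : ℝ)) (fun j => y (j + i)) ∂P = P.real B :=
        fun i => by
          rw [← hint1 hmB, hP]
          conv_rhs => rw [← (ha.isProb.measurePreserving_shift i).map_eq]
          rw [integral_map (ha.isProb.measurePreserving_shift i).aemeasurable]
          rw [(ha.isProb.measurePreserving_shift i).map_eq]
          exact (hintI hmB).aestronglyMeasurable
      simp [this]
    have hEint : Integrable (fun y => max (pathLength S M y / M - v) 0) P :=
      (((ha.integrable_pathLength hgen M).div_const _).sub (integrable_const v)).pos_part
    have hDnn : ∀ y, 0 ≤ D y := fun y =>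
      Finset.sum_nonneg fun i _ => Set.indicator_nonneg (fun _ _ => zero_le_one) _
    have hpt : ∀ᵐ y ∂P, pathLength S M y
        ≤ (((v * M - (v - c) * M * A.indicator (fun _ => (1 : ℝ)) y) + D y) + N)
          + M * max (pathLength S M y / M - v) 0 := by
      filter_upwards [ha.isProb.ae_stepsLaw_coeff_ne_zero] with y hy
      by_cases hyA : y ∈ A
      · have hgreedy := le_of_greedy_blocks
          (F := fun k n => pathLength S n (fun i => y (i + k))) (N := N) (c := c)
          (b := fun i => B.indicator (fun _ => (1 : ℝ)) (fun j => y (j + i)))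
          (fun k m n => by
            have := pathLength_add_le hsymm hgen m n (fun i => y (i + k))
            simpa only [add_assoc, add_comm m k] using this)
          (fun k n => ha.pathLength_le hgen (fun i => hy (i + k)) n) hc0
          (fun k => Set.indicator_nonneg (fun _ _ => zero_le_one) _)
          (fun k hk => by
            -- The shifted path is still slow, so not being bad means that a block of length at most
            -- `N` has slope at most `c`.
            have hnot : (fun j => y (j + k)) ∉ B := fun hmem => by
              simp [hmem] at hk
            by_contra! hcon
            exact hnot ⟨ha.shift_iterate_mem_slowSet hsymm hgen hy hyA k, hcon⟩) M 0
        simp only [add_zero, zero_add] at hgreedy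
        rw [Set.indicator_of_mem hyA]
        have : 0 ≤ (M : ℝ) * max (pathLength S M y / M - v) 0 := by positivity
        linarith
      · rw [Set.indicator_of_notMem hyA]
        have h1 : (M : ℝ) * (pathLength S M y / M - v) ≤ M * max (pathLength S M y / M - v) 0 := by
          gcongr; exact le_max_left _ _
        rw [mul_sub, mul_div_cancel₀ _ hM'.ne'] at h1
        have := hDnn y
        have : (0 : ℝ) ≤ N := N.cast_nonneg
        linarith
    have hI1 : Integrable (fun y => v * M - (v - c) * M * A.indicator (fun _ => (1 : ℝ)) y) P :=
      (integrable_const _).sub ((hintI hmA).const_mul _)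
    have hI2 : Integrable (fun y => v * M - (v - c) * M * A.indicator (fun _ => (1 : ℝ)) y
        + D y) P := hI1.add hDint
    have hI3 : Integrable (fun y => v * M - (v - c) * M * A.indicator (fun _ => (1 : ℝ)) y
        + D y + N) P := hI2.add (integrable_const _)
    have hI := integral_mono_ae (ha.integrable_pathLength hgen M)
      (hI3.add (hEint.const_mul M)) hpt
    rw [ha.isProb.integral_pathLength, ← hP, integral_add' hI3 (hEint.const_mul M),
      integral_add hI2 (integrable_const (N : ℝ)), integral_add hI1 hDint,
      integral_sub (integrable_const _) ((hintI hmA).const_mul _), integral_const_mul,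
      integral_const_mul, hint1 hmA, hDval] at hI
    simp only [integral_const, integral_const_mul, probReal_univ, one_smul] at hI
    change _ ≤ _ + M * R M at hI
    rw [div_le_iff₀ hM']
    calc _ ≤ _ := hI
      _ = _ := by field_simp
  have hbound2 : ∀ N : ℕ, v ≤ v - (v - c) * P.real A + P.real (badSet S c N) + 0 + 0 := fun N => by
    refine le_of_tendsto_of_tendsto hv
      ((tendsto_const_nhds.add (tendsto_const_div_atTop_nhds_zero_nat (N : ℝ))).add hR0) ?_
    filter_upwards [eventually_ne_atTop 0] with M hM
    exact hbound N M hM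
  have hbad : Tendsto (fun N => P.real (badSet S c N)) atTop (𝓝 0) := by
    have h := tendsto_measure_iInter_atTop (μ := P) (s := fun N => badSet S c N)
      (fun N => (measurableSet_badSet S c N).nullMeasurableSet)
      (fun N N' hN y hy => ⟨hy.1, fun n h1 h2 => hy.2 n h1 (h2.trans hN)⟩)
      ⟨0, measure_ne_top _ _⟩
    rw [iInter_badSet, measure_empty] at h
    exact (ENNReal.tendsto_toReal ENNReal.zero_ne_top).comp h
  have hlim : v ≤ v - (v - c) * P.real A + 0 + 0 + 0 :=
    ge_of_tendsto' (((tendsto_const_nhds.add hbad).add tendsto_const_nhds).add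
      tendsto_const_nhds) hbound2
  have h0 : P.real A = 0 := by
    refine le_antisymm ?_ measureReal_nonneg
    have := sub_pos.2 hcv
    by_contra! hpos
    have := mul_pos this hpos
    linarith
  exact (measureReal_eq_zero_iff (measure_ne_top _ _)).1 h0

/-- The speed exists almost surely. -/
lemma IsStep.ae_tendsto_pathLength_div (hsymm : ∀ s ∈ S, s⁻¹ ∈ S)
    (hgen : Subgroup.closure (S : Set G) = ⊤) (ha : IsStep S a) {v : ℝ}
    (hv : Tendsto (fun n : ℕ => meanLength S (a ^ n) / n) atTop (𝓝 v)) :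
    ∀ᵐ y ∂(stepsLaw a), Tendsto (fun n : ℕ => pathLength S n y / n) atTop (𝓝 v) := by
  have hup : ∀ᵐ y ∂(stepsLaw a), ∀ q : ℚ, v < q →
      ∀ᶠ n : ℕ in atTop, pathLength S n y / n < q := by
    rw [ae_all_iff]
    intro q
    by_cases hq : v < q
    · filter_upwards [ha.ae_eventually_le hsymm hgen hv hq] with y hy _ using hy
    · exact ae_of_all _ fun y h => absurd h hq
  have hlow : ∀ᵐ y ∂(stepsLaw a), ∀ q : ℚ, 0 ≤ (q : ℝ) → (q : ℝ) < v → y ∉ slowSet S q := by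
    rw [ae_all_iff]
    intro q
    by_cases hq : 0 ≤ (q : ℝ) ∧ (q : ℝ) < v
    · have h0 := ha.measure_slowSet_eq_zero hsymm hgen hq.1 hq.2 hv
      filter_upwards [measure_eq_zero_iff_ae_notMem.1 h0] with y hy _ _ using hy
    · exact ae_of_all _ fun y h1 h2 => absurd ⟨h1, h2⟩ hq
  filter_upwards [hup, hlow] with y hyup hylow
  rw [tendsto_order]
  constructor
  · intro b hb
    rcases lt_or_ge b 0 with hb0 | hb0
    · exact Eventually.of_forall fun n =>
        hb0.trans_le (div_nonneg (pathLength_nonneg n y) n.cast_nonneg)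
    · obtain ⟨q, hbq, hqv⟩ := exists_rat_btwn hb
      -- Membership in `slowSet S q` asks for a rational slope strictly below `q`, hence a second
      -- rational.
      obtain ⟨r, hbr, hrq⟩ := exists_rat_btwn hbq
      have hnot := hylow q (hb0.trans hbq.le) hqv
      have hev : ∀ᶠ n : ℕ in atTop, ¬ pathLength S n y ≤ r * n :=
        not_frequently.1 fun hf => hnot ⟨r, hrq, hf⟩
      filter_upwards [hev, eventually_ne_atTop 0] with n hn hn0
      have hn' : (0 : ℝ) < n := by positivity
      rw [lt_div_iff₀ hn']
      exact (mul_lt_mul_of_pos_right hbr hn').trans (not_le.1 hn)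
  · intro b hb
    obtain ⟨q, hvq, hqb⟩ := exists_rat_btwn hb
    filter_upwards [hyup q hvq] with n hn using hn.trans hqb

end Measurable

end GroupWalk

end

noncomputable section

namespace GroupWalk

/-- Every `x` is charged by the power `|x|` of the uniform step, so `G` is a countable union of
finite supports. -/
lemma countable_of_closure_eq_top {G : Type*} [Group G] {S : Finset G} (hne : S.Nonempty)
    (hsymm : ∀ s ∈ S, s⁻¹ ∈ S) (hgen : Subgroup.closure (S : Set G) = ⊤) : Countable G := by
  refine Set.countable_univ_iff.1 ((Set.countable_iUnion fun n : ℕ =>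
    (srwStep S ^ n).coeff.support.countable_toSet).mono fun x _ => Set.mem_iUnion.2
      ⟨wordLength S x, Finsupp.mem_support_iff.2 (ne_of_gt ?_)⟩)
  have := hne.card_pos
  exact lt_of_lt_of_le (by positivity) (inv_card_pow_le_coeff_srwStep_pow hne hsymm hgen x)

end GroupWalk

end

theorem mainTheorem4 {G : Type*} [Group G] (S : Finset G) (hne : S.Nonempty)
    (hsymm : ∀ s ∈ S, s⁻¹ ∈ S) (hgen : Subgroup.closure (S : Set G) = ⊤)
    (p : G → G → ℝ) (hp : p = GroupWalk.srw S ∨ p = GroupWalk.lazyRW S)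
    {Ω : Type*} [MeasurableSpace Ω] (μ : Measure Ω) [IsProbabilityMeasure μ]
    (X : ℕ → Ω → G) (hX : GroupWalk.IsMarkovChain p 1 μ X) :
    ∃ v h : ℝ,
      Tendsto (fun n : ℕ => (∫ ω, (GroupWalk.wordLength S (X n ω) : ℝ) ∂μ) / n) atTop (𝓝 v) ∧
      (∀ᵐ ω ∂μ, Tendsto (fun n : ℕ => (GroupWalk.wordLength S (X n ω) : ℝ) / n) atTop (𝓝 v)) ∧
      Tendsto (fun n : ℕ => GroupWalk.entropy μ (X n) / n) atTop (𝓝 h) ∧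
      List.TFAE [0 < v,
        ∃ u : G → ℝ, (∃ C : ℝ, ∀ x, |u x| ≤ C) ∧ GroupWalk.IsHarmonic S u ∧ ∃ x y, u x ≠ u y,
        0 < h] := by
  have := GroupWalk.countable_of_closure_eq_top hne hsymm hgen
  let _ : MeasurableSpace G := ⊤
  obtain ⟨a, ha, hstep, hpa⟩ : ∃ a : MonoidAlgebra ℝ G,
      (a = GroupWalk.srwStep S ∨ a = GroupWalk.lazyStep S) ∧ GroupWalk.IsStep S a ∧
        ∀ x y, p x y = a.coeff (x⁻¹ * y) := by
    rcases hp with rfl | rfl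
    · exact ⟨_, Or.inl rfl, GroupWalk.isStep_srwStep hne hsymm, GroupWalk.srw_eq_coeff S⟩
    · exact ⟨_, Or.inr rfl, GroupWalk.isStep_lazyStep hne hsymm, GroupWalk.lazyRW_eq_coeff S⟩
  have hprob := hstep.isProb
  obtain ⟨v, hv, -⟩ := GroupWalk.exists_tendsto_div_of_subadditive
    (hstep.subadditive_meanLength hsymm hgen) fun n => (hprob.pow n).meanLength_nonneg
  obtain ⟨h, hh, -⟩ := GroupWalk.exists_tendsto_div_of_subadditive hstep.subadditive_H
    fun n => (hprob.pow n).H_nonneg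
  refine ⟨v, h, ?_, ?_, ?_, ?_⟩
  · simpa only [hX.integral_wordLength hprob hpa S] using hv
  · obtain ⟨hm, hmap⟩ := hX.map_increments hprob hpa
    have hae := hstep.ae_tendsto_pathLength_div hsymm hgen hv
    -- The increments have law `stepsLaw a`, so the almost sure limit pulls back to `Ω`, where `X n`
    -- is the product of its increments.
    rw [← hmap] at hae
    filter_upwards [ae_of_ae_map hm.aemeasurable hae, hX.ae_start] with ω hω h0
    simpa only [GroupWalk.pathLength, GroupWalk.pathProd_increments h0] using hω
  · simpa only [hX.entropy_eq hprob hpa] using hh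
  · have h13 := hstep.speed_pos_iff_entropy_pos hne hsymm hgen hv hh
    have h23 := GroupWalk.exists_harmonic_iff_entropy_pos hne hsymm hgen ha hh
    tfae_have 1 ↔ 3 := h13
    tfae_have 2 ↔ 3 := h23
    tfae_finish
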